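/- **Setting.** The parameters are $x=(X_1,\dots,X_{N_L})\in\mathbb R^d$ with $N_L\ge1$ weight matrices $X_\ell\in\mathbb R^{m_\ell\times n_\ell}$, $d=\sum_\ell m_\ell n_\ell$, with the Euclidean norm; $\nabla_\ell$ is the gradient with respect to $X_\ell$. The objective is $f(x)=\mathbb E_{\xi\sim\mathcal D}F(x;\xi)$. Assume $f$ is bounded below; $f$ is differentiable with $\|\nabla f(x)-\nabla f(y)\|_2\le L\|x-y\|_2$ for all $x,y$, where $L>0$; and, for every $x$ and $\ell$, $\mathbb E_\xi[\nabla_\ell F(x;\xi)]=\nabla_\ell f(x)$ and $\mathbb E_\xi\|\nabla_\ell F(x;\xi)-\nabla_\ell f(x)\|_F^2\le\sigma_\ell^2$, with $\sigma_\ell\ge 0$. Put $\sigma=\sqrt{\sum_\ell\sigma_\ell^2}$, $\Delta=f(x^{(0)})-\inf f$ and $\underline\delta=\min_\ell r_\ell/\min\{m_\ell,n_\ell\}$, where $1\le r_\ell\le\min\{m_\ell,n_\ell\}$ are the projection ranks. **Algorithm** (large-batch GaLore using momentum SGD with momentum projection; momentum parameter $\beta_1$, learning rate $\eta$, period $\tau$,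 batch size $\mathcal B$). Start from $x^{(0)}$ with zero momentum. In iteration $t$: if $\tau\mid t$, draw fresh i.i.d. samples $\xi^{(t,1)},\dots,\xi^{(t,\mathcal B)}\sim\mathcal D$, set $G_\ell=\frac1{\mathcal B}\sum_b\nabla_\ell F(x^{(t)};\xi^{(t,b)})$, take a singular value decomposition $G_\ell=U\Sigma V^\top$ (singular values in nonincreasing order), and set $P_\ell^{(t)}=U[:,:r_\ell]$ if $m_\ell\le n_\ell$, or $Q_\ell^{(t)}=V[:,:r_\ell]$ if $m_\ell>n_\ell$; if $\tau\nmid t$, draw one fresh sample $\xi^{(t)}\sim\mathcal D$, set $G_\ell=\nabla_\ell F(x^{(t)};\xi^{(t)})$ and keep $P_\ell^{(t)}=P_\ell^{(t-1)}$, $Q_\ell^{(t)}=Q_\ell^{(t-1)}$. For $m_\ell\le n_\ell$ let $$M_\ell^{(t)}=(1-\beta_1)(P_\ell^{(t)})^\top P_\ell^{(t-1)}M_\ell^{(t-1)}+\beta_1(P_\ell^{(t)})^\top G_\ell,\qquad X_\ell^{(t+1)}=X_\ell^{(t)}-\eta P_\ell^{(t)}M_\ell^{(t)},$$ and for $m_\ell>n_\ell$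 let $$M_\ell^{(t)}=(1-\beta_1)M_\ell^{(t-1)}(Q_\ell^{(t-1)})^\top Q_\ell^{(t)}+\beta_1G_\ell Q_\ell^{(t)},\qquad X_\ell^{(t+1)}=X_\ell^{(t)}-\eta M_\ell^{(t)}(Q_\ell^{(t)})^\top.$$ (If $\tau\nmid t$, the factors $(P_\ell^{(t)})^\top P_\ell^{(t-1)}$ and $(Q_\ell^{(t-1)})^\top Q_\ell^{(t)}$ are the identity.) **Theorem.** (i) If $0<\beta_1\le1$, $\tau\ge\frac{64}{3\beta_1\underline\delta}$, $\mathcal B\ge1$ and $0<\eta\le\min\Big\{\frac1{4L},\sqrt{\frac{3\underline\delta\beta_1^2}{80L^2}},\sqrt{\frac{\underline\delta}{40\tau^2L^2}},\sqrt{\frac{3\beta_1}{32\tau L^2}}\Big\}$, then for every integer $K\ge1$ $$\frac1{K\tau}\sum_{t=0}^{K\tau-1}\mathbb E\|\nabla f(x^{(t)})\|_2^2\le\frac{16\Delta}{\underline\delta\eta K\tau}+\Big(\frac{160}{3\beta_1\underline\delta\tau\mathcal B}+\frac{352}{3\underline\delta^2\mathcal B}+\frac{32\beta_1}{3\underline\delta}\Big)\sigma^2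 .$$ There is moreover an absolute constant $C>0$, independent of all the data, such that (ii) and (iii) hold whenever $\Delta>0$. (ii) If the integer $T$ satisfies $T\ge2+\frac{128}{3\underline\delta}+\frac{(128\sigma)^2}{9\sqrt{\underline\delta}L\Delta}$ and $$\beta_1=\Big(1+\sqrt{\tfrac{\underline\delta^{3/2}\sigma^2T}{L\Delta}}\Big)^{-1},\quad \tau=\Big\lceil\tfrac{64}{3\underline\delta\beta_1}\Big\rceil,\quad \mathcal B=\Big\lceil\tfrac1{\underline\delta\beta_1}\Big\rceil,\quad \eta=\Big(4L+\sqrt{\tfrac{80L^2}{3\underline\delta\beta_1^2}}+\sqrt{\tfrac{40\tau^2L^2}{\underline\delta}}+\sqrt{\tfrac{32\tau L^2}{3\beta_1}}\Big)^{-1},$$ then $$\frac1T\sum_{t=0}^{T-1}\mathbb E\|\nabla f(x^{(t)})\|_2^2\le C\Big(\frac{L\Delta}{\underline\delta^{5/2}T}+\sqrt{\frac{L\Delta\sigma^2}{\underline\delta^{7/2}T}}\Big).$$ (iii) For every $\varepsilon>0$ there is a $T$ as in (ii) for which the algorithm with the hyperparameters of (ii) satisfies $\frac1T\sum_{t=0}^{T-1}\mathbb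 E\|\nabla f(x^{(t)})\|_2^2\le\varepsilon$ and evaluates in its $T$ iterations altogether at most $$C\Big(\frac{L\Delta\sigma^2}{\underline\delta^{7/2}\varepsilon^2}+\frac{L\Delta}{\underline\delta^{5/2}\varepsilon}+\frac{\sigma^2}{\underline\delta^{1/2}L\Delta}+\frac1{\underline\delta}\Big)$$ stochastic gradients $\nabla F(x;\xi)$. -/

import Mathlib

open MeasureTheory ProbabilityTheory

noncomputable section

namespace GaLore

/-- Shapes of the model: `N ≥ 1` weight matrices, the `ℓ`-th of size `m ℓ × n ℓ`, together with
the projection ranks `1 ≤ r ℓ ≤ min (m ℓ) (n ℓ)`. -/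
structure Arch where
  N : ℕ
  m : Fin N → ℕ
  n : Fin N → ℕ
  r : Fin N → ℕ
  N_pos : 0 < N
  r_pos : ∀ l, 0 < r l
  r_le : ∀ l, r l ≤ min (m l) (n l)

/-- The parameter space `ℝ^d`, `d = ∑ m ℓ * n ℓ`, with the Euclidean norm; the coordinate
`⟨ℓ, i, j⟩` is the entry `(i, j)` of the `ℓ`-th weight matrix. -/
abbrev Arch.Params (A : Arch) : Type :=
  EuclideanSpace ℝ (Σ l : Fin A.N, Fin (A.m l) × Fin (A.n l))

/-- The `ℓ`-th weight matrix of a parameter vector. -/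
def layer {A : Arch} (x : A.Params) (l : Fin A.N) : Matrix (Fin (A.m l)) (Fin (A.n l)) ℝ :=
  Matrix.of fun i j => x ⟨l, i, j⟩

/-- The parameter vector with given weight matrices. -/
def ofLayers {A : Arch} (X : ∀ l : Fin A.N, Matrix (Fin (A.m l)) (Fin (A.n l)) ℝ) : A.Params :=
  WithLp.toLp 2 fun p => X p.1 p.2.1 p.2.2

/-- Relative rank `δ_ℓ = r_ℓ / min {m_ℓ, n_ℓ}`. -/
def Arch.delta (A : Arch) (l : Fin A.N) : ℝ := (A.r l : ℝ) / (min (A.m l) (A.n l) : ℕ)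

/-- The smallest relative rank `min_ℓ δ_ℓ`. -/
def Arch.minDelta (A : Arch) : ℝ := ⨅ l, A.delta l

/-- Squared Frobenius norm. -/
def frobSq {m n : ℕ} (G : Matrix (Fin m) (Fin n) ℝ) : ℝ := ∑ i, ∑ j, G i j ^ 2

/-! ### The optimization problem -/

/-- The objective `f x = 𝔼_{ξ ∼ D} F (x; ξ)`. -/
def objective {A : Arch} {Ξ : Type*} [MeasurableSpace Ξ] (D : Measure Ξ) (F : A.Params → Ξ → ℝ) :
    A.Params → ℝ :=
  fun x => ∫ z, F x z ∂D

/-- Lower boundedness. -/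
def LowerBounded {A : Arch} (f : A.Params → ℝ) : Prop := BddBelow (Set.range f)

/-- `L`-smoothness. -/
def LSmooth {A : Arch} (f : A.Params → ℝ) (L : ℝ) : Prop :=
  Differentiable ℝ f ∧ ∀ x y, ‖gradient f x - gradient f y‖ ≤ L * ‖x - y‖

/-- The layer gradient `∇_ℓ f (x)`. -/
def layerGrad {A : Arch} (f : A.Params → ℝ) (x : A.Params) (l : Fin A.N) :
    Matrix (Fin (A.m l)) (Fin (A.n l)) ℝ :=
  layer (gradient f x) l

/-- The sample loss `F` is measurable and integrable in the sample and differentiable in the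
parameters, and its layer gradients are unbiased with variance at most `σ_ℓ²`.
(Integrability of the entries of `∇_ℓ F (x; ξ)` follows from that of the variance integrand.) -/
structure StochasticGradient {A : Arch} {Ξ : Type*} [MeasurableSpace Ξ] (D : Measure Ξ)
    (F : A.Params → Ξ → ℝ) (σ : Fin A.N → ℝ) : Prop where
  measurable : ∀ x, Measurable (F x)
  integrable : ∀ x, Integrable (F x) D
  differentiable : ∀ z, Differentiable ℝ fun x => F x z
  unbiased : ∀ x l i j,
    ∫ z, layerGrad (fun y => F y z) x l i j ∂D = layerGrad (objective D F) x l i j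
  variance_integrable : ∀ x l, Integrable
    (fun z => frobSq (layerGrad (fun y => F y z) x l - layerGrad (objective D F) x l)) D
  variance_le : ∀ x l,
    ∫ z, frobSq (layerGrad (fun y => F y z) x l - layerGrad (objective D F) x l) ∂D ≤ σ l ^ 2

/-- Total noise level `σ = √(∑ σ_ℓ²)`. -/
def totalSigma {A : Arch} (σ : Fin A.N → ℝ) : ℝ := Real.sqrt (∑ l, σ l ^ 2)

/-- Initial gap `Δ = f (x⁰) - inf f`. -/
def gap {A : Arch} (f : A.Params → ℝ) (x0 : A.Params) : ℝ := f x0 - ⨅ x, f x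

/-! ### Singular value decomposition -/

/-- Candidate factors `(U, Σ, V)` of a decomposition `G = U Σ Vᵀ`. -/
structure SVDFactors (m n : ℕ) where
  U : Matrix (Fin m) (Fin m) ℝ
  S : Matrix (Fin m) (Fin n) ℝ
  V : Matrix (Fin n) (Fin n) ℝ

/-- `s` is a singular value decomposition of `G`: `U` and `V` are orthogonal, `G = U Σ Vᵀ`, and
`Σ` is rectangular diagonal with nonnegative, nonincreasing diagonal. -/
structure IsSVD {m n : ℕ} (G : Matrix (Fin m) (Fin n) ℝ) (s : SVDFactors m n) : Prop where
  orthogonal_U : s.U ∈ Matrix.orthogonalGroup (Fin m) ℝ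
  orthogonal_V : s.V ∈ Matrix.orthogonalGroup (Fin n) ℝ
  eq_mul : G = s.U * s.S * s.V.transpose
  diag : ∀ (i : Fin m) (j : Fin n), (i : ℕ) ≠ j → s.S i j = 0
  nonneg : ∀ (i : Fin m) (j : Fin n), 0 ≤ s.S i j
  antitone : ∀ (i i' : Fin m) (j j' : Fin n), (i : ℕ) = j → (i' : ℕ) = j' → i ≤ i' →
    s.S i' j' ≤ s.S i j

/-- A rule that chooses a decomposition for each iteration, layer and matrix. -/
abbrev SVDRule (A : Arch) : Type :=
  ℕ → ∀ l : Fin A.N, Matrix (Fin (A.m l)) (Fin (A.n l)) ℝ → SVDFactors (A.m l) (A.n l)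

/-- The rule always returns a singular value decomposition, and the entries of its singular
vectors are Borel functions of the entries of the decomposed matrix. -/
structure SVDRule.Valid {A : Arch} (svd : SVDRule A) : Prop where
  isSVD : ∀ t l G, IsSVD G (svd t l G)
  measurable_U : ∀ t l i k, Measurable
    fun G : Fin (A.m l) → Fin (A.n l) → ℝ => (svd t l (Matrix.of G)).U i k
  measurable_V : ∀ t l j k, Measurable
    fun G : Fin (A.m l) → Fin (A.n l) → ℝ => (svd t l (Matrix.of G)).V j k

/-- The first `r` columns `U[:, :r]`. -/
def firstCols {m r : ℕ} (h : r ≤ m) (U : Matrix (Fin m) (Fin m) ℝ) : Matrix (Fin m) (Fin r) ℝ :=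
  U.submatrix id (Fin.castLE h)

/-! ### The algorithm -/

/-- Hyperparameters: momentum parameter `β`, learning rate `η`, subspace changing frequency `τ`,
large batch size `B`. -/
structure Hyper where
  β : ℝ
  η : ℝ
  τ : ℕ
  B : ℕ

/-- Memory kept for one layer between iterations: the projection matrices and the momentum. For
`m ≤ n` only `P` and `Mleft` are used, for `m > n` only `Q` and `Mright`. -/
structure LayerMem (m n r : ℕ) where
  P : Matrix (Fin m) (Fin r) ℝ
  Q : Matrix (Fin n) (Fin r) ℝ
  Mleft : Matrix (Fin r) (Fin n) ℝ
  Mright : Matrix (Fin m) (Fin r) ℝ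

/-- State at the beginning of an iteration. -/
structure State (A : Arch) where
  x : A.Params
  mem : ∀ l : Fin A.N, LayerMem (A.m l) (A.n l) (A.r l)

/-- Initial state: momentum zero. (The projections held before the first switch are irrelevant,
as they only multiply the zero momentum.) -/
def initState {A : Arch} (x0 : A.Params) : State A where
  x := x0
  mem := fun _ => ⟨0, 0, 0, 0⟩

/-- Number of stochastic gradients evaluated in iteration `t`. -/
def Hyper.batch (H : Hyper) (t : ℕ) : ℕ := if t % H.τ = 0 then H.B else 1

/-- The gradient estimate `G_ℓ` of iteration `t` at `x` from the samples `z 0, z 1, …`: the average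
over the `B` samples `z 0, …, z (B - 1)` at a subspace switch, the single sample `z 0` otherwise. -/
def gradEst {A : Arch} {Ξ : Type*} (H : Hyper) (F : A.Params → Ξ → ℝ) (t : ℕ) (x : A.Params)
    (z : ℕ → Ξ) (l : Fin A.N) : Matrix (Fin (A.m l)) (Fin (A.n l)) ℝ :=
  if t % H.τ = 0 then
    (1 / (H.B : ℝ)) • ∑ b ∈ Finset.range H.B, layerGrad (fun y => F y (z b)) x l
  else layerGrad (fun y => F y (z 0)) x l

/-- Update of projection and momentum of one layer in iteration `t`, given the gradient estimate
`G` and its decomposition `s` (used only when the subspace switches). -/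
def updateMem {m n r : ℕ} (h : r ≤ min m n) (H : Hyper) (t : ℕ) (G : Matrix (Fin m) (Fin n) ℝ)
    (s : SVDFactors m n) (c : LayerMem m n r) : LayerMem m n r :=
  if t % H.τ = 0 then
    if m ≤ n then
      let P := firstCols (h.trans (min_le_left m n)) s.U
      { c with
        P := P
        Mleft := (1 - H.β) • (P.transpose * c.P * c.Mleft) + H.β • (P.transpose * G) }
    else
      let Q := firstCols (h.trans (min_le_right m n)) s.V
      { c with
        Q := Q
        Mright := (1 - H.β) • (c.Mright * c.Q.transpose * Q) + H.β • (G * Q) }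
  else
    if m ≤ n then
      { c with Mleft := (1 - H.β) • c.Mleft + H.β • (c.P.transpose * G) }
    else
      { c with Mright := (1 - H.β) • c.Mright + H.β • (G * c.Q) }

/-- The momentum mapped back to the full space: `P M` if `m ≤ n`, and `M Qᵀ` if `m > n`. -/
def LayerMem.direction {m n r : ℕ} (c : LayerMem m n r) : Matrix (Fin m) (Fin n) ℝ :=
  if m ≤ n then c.P * c.Mleft else c.Mright * c.Q.transpose

/-- One iteration of large-batch GaLore with momentum SGD and momentum projection. -/
def step {A : Arch} {Ξ : Type*} (H : Hyper) (F : A.Params → Ξ → ℝ) (svd : SVDRule A) (t : ℕ)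
    (z : ℕ → Ξ) (s : State A) : State A :=
  let mem' := fun l =>
    let G := gradEst H F t s.x z l
    updateMem (A.r_le l) H t G (svd t l G) (s.mem l)
  { x := ofLayers fun l => layer s.x l - H.η • (mem' l).direction
    mem := mem' }

/-- The state before iteration `t`, started at `x0` and run on the samples `z t b`. -/
def run {A : Arch} {Ξ : Type*} (H : Hyper) (F : A.Params → Ξ → ℝ) (svd : SVDRule A)
    (x0 : A.Params) (z : ℕ → ℕ → Ξ) : ℕ → State A
  | 0 => initState x0
  | t + 1 => step H F svd t (z t) (run H F svd x0 z t)

/-- The iterate `x^(t)` as a random variable. -/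
def iterate {A : Arch} {Ξ Ω : Type*} (H : Hyper) (F : A.Params → Ξ → ℝ) (svd : SVDRule A)
    (x0 : A.Params) (ξ : ℕ → ℕ → Ω → Ξ) (t : ℕ) (ω : Ω) : A.Params :=
  (run H F svd x0 (fun s b => ξ s b ω) t).x

/-- The samples `ξ t b` are independent with common law `D`. -/
structure IIDSamples {Ξ Ω : Type*} [MeasurableSpace Ξ] [MeasurableSpace Ω] (D : Measure Ξ)
    (μ : Measure Ω) (ξ : ℕ → ℕ → Ω → Ξ) : Prop where
  measurable : ∀ t b, Measurable (ξ t b)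
  law : ∀ t b, μ.map (ξ t b) = D
  indep : iIndepFun (fun p : ℕ × ℕ => ξ p.1 p.2) μ

/-- `(1/T) ∑_{t<T} 𝔼 ‖∇f (x^(t))‖² ≤ bound`, all the expectations being finite. -/
def AvgGradSqLE {A : Arch} {Ω : Type*} [MeasurableSpace Ω] (μ : Measure Ω) (f : A.Params → ℝ)
    (X : ℕ → Ω → A.Params) (T : ℕ) (bound : ℝ) : Prop :=
  (∀ t < T, Integrable (fun ω => ‖gradient f (X t ω)‖ ^ 2) μ) ∧
    (1 / (T : ℝ)) * ∑ t ∈ Finset.range T, ∫ ω, ‖gradient f (X t ω)‖ ^ 2 ∂μ ≤ bound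

/-- Number of stochastic gradients evaluated in the first `T` iterations. -/
def Hyper.gradEvals (H : Hyper) (T : ℕ) : ℕ := ∑ t ∈ Finset.range T, H.batch t

/-- Hyperparameters chosen for the horizon `T`. -/
def hyperFor (δ L Δ σ : ℝ) (T : ℕ) : Hyper :=
  let β : ℝ := (1 + Real.sqrt (δ ^ (3 / 2 : ℝ) * σ ^ 2 * T / (L * Δ)))⁻¹
  let τ : ℕ := ⌈64 / (3 * δ * β)⌉₊
  { β := β
    τ := τ
    η := (4 * L + Real.sqrt (80 * L ^ 2 / (3 * δ * β ^ 2)) +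
      Real.sqrt (40 * (τ : ℝ) ^ 2 * L ^ 2 / δ) + Real.sqrt (32 * (τ : ℝ) * L ^ 2 / (3 * β)))⁻¹
    B := ⌈1 / (δ * β)⌉₊ }

/-- The horizon is long enough. -/
def LongHorizon (δ L Δ σ : ℝ) (T : ℕ) : Prop :=
  2 + 128 / (3 * δ) + (128 * σ) ^ 2 / (9 * Real.sqrt δ * L * Δ) ≤ (T : ℝ)

end GaLore

end

/-! All layers are put into one Euclidean space. Mapped back to full size, the momentum `m` obeys
`m⁺ = p⁺((1 - β) m + β g)`, where `p⁺` is the block-diagonal orthogonal projection onto the current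
subspaces and `g` the gradient estimate: transporting `M` between bases by `(P⁺)ᵀ P` is the same as
projecting `P M`. So the method is momentum SGD with a random, piecewise constant projection,
axiomatized as `ProjectedMomentum` and matched with the algorithm in `projectedMomentum_run`.

The descent lemma gains `η/2 ‖∇f‖²` plus a multiple of the squared step, and loses `η/2 ‖∇f - m⁺‖²`.
As `m⁺` lies in the range of `p⁺`, Pythagoras splits this loss into a projection error `‖∇f -
p⁺∇f‖²` and a momentum error `‖m⁺ - p⁺∇f‖²`.

Projection error (`projection_error_le`): the top singular vectors of the large-batch gradient keep
a fraction `δ` of its energy (`IsSVD.capture`, by Chebyshev's sum inequality). Batch noise and drift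
of the iterates within a period are small, so at most a fraction `1 - δ/2` of `‖∇f‖²` is lost, up to
these perturbations.

Momentum error (`momentum_error_le`, `lagged_error_le`): it contracts by `1 - β` per iteration, with
noise `β²σ²` because fresh samples are orthogonal to the past. At a switch the new projection
depends on the fresh noise, so it is removed by nonexpansiveness at the price of one extra `‖∇f‖²`.
This price is paid once in `τ` iterations; `τ ≥ 64/(3βδ)` makes it a small part of the gained `δ/2`.

The step-size caps let the squared steps of the descent lemma absorb all drift
(`sum_le_of_recursions`), which gives (i). For (ii), `T` is rounded up to full periods of total
length at most `2T`, and `β` balances the optimization term against the noise term. For (iii), `B ≤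
τ` keeps the number of sampled gradients below `3T`. -/

namespace GaLore

/-! ### Orthogonal projections and smooth functions -/

section Hilbert

variable {E : Type*} [NormedAddCommGroup E] [InnerProductSpace ℝ E]

theorem norm_add_sub_apply_sq {p : E →ₗ[ℝ] E} (hp : p.IsSymmetricProjection) {u : E}
    (hu : p u = u) (v : E) : ‖u + (v - p v)‖ ^ 2 = ‖u‖ ^ 2 + ‖v - p v‖ ^ 2 := by
  have h : inner ℝ u (v - p v) = 0 := by
    have := hp.isSymmetric u v
    rw [hu] at this
    rw [inner_sub_right, this, sub_self]
  rw [norm_add_sq_real, h]; ring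

theorem apply_apply_of_projection {p : E →ₗ[ℝ] E} (hp : p.IsSymmetricProjection) (v : E) :
    p (p v) = p v :=
  LinearMap.congr_fun hp.isIdempotentElem.eq v

theorem norm_sub_sq_of_projection {p : E →ₗ[ℝ] E} (hp : p.IsSymmetricProjection) {u : E}
    (hu : p u = u) (v : E) : ‖v - u‖ ^ 2 = ‖u - p v‖ ^ 2 + ‖v - p v‖ ^ 2 := by
  have h := norm_add_sub_apply_sq hp (u := p v - u)
    (by rw [map_sub, apply_apply_of_projection hp, hu]) v
  rw [norm_sub_rev u, ← h]
  congr 2; abel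

theorem norm_sq_of_projection {p : E →ₗ[ℝ] E} (hp : p.IsSymmetricProjection) (v : E) :
    ‖v‖ ^ 2 = ‖p v‖ ^ 2 + ‖v - p v‖ ^ 2 := by
  simpa using norm_sub_sq_of_projection hp (map_zero p) v

theorem norm_apply_le_of_projection {p : E →ₗ[ℝ] E} (hp : p.IsSymmetricProjection) (v : E) :
    ‖p v‖ ≤ ‖v‖ := by
  have := norm_sq_of_projection hp v
  exact le_of_sq_le_sq (by nlinarith [sq_nonneg ‖v - p v‖]) (norm_nonneg _)

theorem norm_sub_apply_le_of_projection {p : E →ₗ[ℝ] E} (hp : p.IsSymmetricProjection) (v : E) :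
    ‖v - p v‖ ≤ ‖v‖ := by
  have := norm_sq_of_projection hp v
  exact le_of_sq_le_sq (by nlinarith [sq_nonneg ‖p v‖]) (norm_nonneg _)

theorem add_sq_le_weighted {a b c : ℝ} (hc : 0 < c) :
    (a + b) ^ 2 ≤ (1 + c) * a ^ 2 + (1 + 1 / c) * b ^ 2 := by
  have h : 0 ≤ (c * a - b) ^ 2 / c := by positivity
  have e : (c * a - b) ^ 2 / c = c * a ^ 2 - 2 * a * b + 1 / c * b ^ 2 := by field_simp; ring
  nlinarith

/-- If `p` captures a fraction `δ` of the energy of `w`, then it captures at least `δ / 2` of the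
energy of `v`, up to the distance of `v` and `w`. -/
theorem norm_sub_apply_sq_le_of_capture {p : E →ₗ[ℝ] E} (hp : p.IsSymmetricProjection) {δ : ℝ}
    (h0 : 0 < δ) (h1 : δ ≤ 1) {w : E} (hw : ‖w - p w‖ ^ 2 ≤ (1 - δ) * ‖w‖ ^ 2) (v : E) :
    ‖v - p v‖ ^ 2 ≤ (1 - δ / 2) * ‖v‖ ^ 2 + 8 / δ * ‖v - w‖ ^ 2 := by
  have e1 : ‖v - p v‖ ≤ ‖w - p w‖ + ‖v - w‖ := by
    have : v - p v = (w - p w) + ((v - w) - p (v - w)) := by rw [map_sub]; abel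
    rw [this]
    exact (norm_add_le _ _).trans
      (add_le_add le_rfl (norm_sub_apply_le_of_projection hp _))
  have e2 : ‖w‖ ≤ ‖v‖ + ‖v - w‖ := by
    have : w = v - (v - w) := by abel
    calc ‖w‖ = ‖v - (v - w)‖ := by rw [← this]
      _ ≤ _ := norm_sub_le _ _
  -- The weight `δ/4` is used in both Young inequalities, since `(1 - δ)(1 + δ/4)² ≤ 1 - δ/2`.
  have hd : 0 < δ / 4 := by positivity
  have s1 : ‖v - p v‖ ^ 2 ≤ (‖w - p w‖ + ‖v - w‖) ^ 2 := by gcongr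
  have s2 : ‖w‖ ^ 2 ≤ (‖v‖ + ‖v - w‖) ^ 2 := by gcongr
  have s3 := add_sq_le_weighted (a := ‖w - p w‖) (b := ‖v - w‖) hd
  have s4 := add_sq_le_weighted (a := ‖v‖) (b := ‖v - w‖) hd
  have s5 : (1 + δ / 4) * ‖w - p w‖ ^ 2 ≤ (1 + δ / 4) * ((1 - δ) *
      ((1 + δ / 4) * ‖v‖ ^ 2 + (1 + 1 / (δ / 4)) * ‖v - w‖ ^ 2)) := by
    refine mul_le_mul_of_nonneg_left (hw.trans ?_) (by positivity)
    exact mul_le_mul_of_nonneg_left (s2.trans s4) (by linarith)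
  have c1 : (1 + δ / 4) * ((1 - δ) * (1 + δ / 4)) ≤ 1 - δ / 2 := by
    nlinarith [mul_pos h0 h0, mul_pos (mul_pos h0 h0) h0]
  have c2 : (1 + δ / 4) * ((1 - δ) * (1 + 1 / (δ / 4))) + (1 + 1 / (δ / 4)) ≤ 8 / δ := by
    have : 8 / δ - ((1 + δ / 4) * ((1 - δ) * (1 + 1 / (δ / 4))) + (1 + 1 / (δ / 4))) =
        1 + 7 / 4 * δ + δ ^ 2 / 4 := by field_simp; ring
    nlinarith [sq_nonneg δ]
  have t1 := mul_le_mul_of_nonneg_right c1 (sq_nonneg ‖v‖)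
  have t2 := mul_le_mul_of_nonneg_right c2 (sq_nonneg ‖v - w‖)
  nlinarith

variable [CompleteSpace E]

theorem le_quadratic_of_lipschitz_gradient {f : E → ℝ} {L : ℝ} (hf : Differentiable ℝ f)
    (hL : ∀ x y, ‖gradient f x - gradient f y‖ ≤ L * ‖x - y‖) (x v : E) :
    f (x + v) ≤ f x + inner ℝ (gradient f x) v + L / 2 * ‖v‖ ^ 2 := by
  -- `φ` is `f` on the segment minus its quadratic upper model, up to a constant. Lipschitz
  -- continuity makes its derivative nonpositive on `[0, 1]`, and comparing the endpoints gives the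
  -- claim.
  set φ : ℝ → ℝ := fun t => f (x + t • v) - t * inner ℝ (gradient f x) v - L / 2 * ‖v‖ ^ 2 * t ^ 2
  have hd : ∀ t, HasDerivAt φ (inner ℝ (gradient f (x + t • v)) v - inner ℝ (gradient f x) v
      - L * ‖v‖ ^ 2 * t) t := by
    intro t
    have h1 : HasDerivAt (fun t : ℝ => x + t • v) v t := by
      simpa using ((hasDerivAt_id t).smul_const v).const_add x
    have h2 : HasDerivAt (fun t : ℝ => f (x + t • v)) (inner ℝ (gradient f (x + t • v)) v) t := by
      have := (hf (x + t • v)).hasGradientAt.hasFDerivAt.comp_hasDerivAt t h1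
      simpa [Function.comp_def] using this
    have h3 := (h2.sub ((hasDerivAt_id t).mul_const (inner ℝ (gradient f x) v))).sub
      ((hasDerivAt_pow 2 t).const_mul (L / 2 * ‖v‖ ^ 2))
    refine h3.congr_deriv ?_
    simp; ring
  have anti : AntitoneOn φ (Set.Icc 0 1) := by
    refine antitoneOn_of_deriv_nonpos (convex_Icc 0 1)
      (fun t _ => (hd t).continuousAt.continuousWithinAt)
      (fun t _ => (hd t).differentiableAt.differentiableWithinAt) ?_
    intro t ht
    rw [interior_Icc] at ht
    rw [(hd t).deriv, ← inner_sub_left]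
    have h1 := real_inner_le_norm (gradient f (x + t • v) - gradient f x) v
    have h2 := hL (x + t • v) x
    rw [add_sub_cancel_left, norm_smul, Real.norm_of_nonneg ht.1.le] at h2
    nlinarith [norm_nonneg v, mul_le_mul_of_nonneg_right h2 (norm_nonneg v)]
  have h := anti (by simp) (by simp) (zero_le_one' ℝ)
  simp only [φ, one_smul, zero_smul, add_zero] at h
  linarith

theorem continuous_gradient_of_lipschitz {f : E → ℝ} {L : ℝ}
    (hL : ∀ x y, ‖gradient f x - gradient f y‖ ≤ L * ‖x - y‖) : Continuous (gradient f) := by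
  have : LipschitzWith L.toNNReal (gradient f) := LipschitzWith.of_dist_le_mul fun x y => by
    rw [dist_eq_norm, dist_eq_norm]
    refine (hL x y).trans ?_
    gcongr
    exact Real.le_coe_toNNReal L
  exact this.continuous

/-- One step `x ↦ x - η m` along an arbitrary direction. -/
theorem descent_step {f : E → ℝ} {L η : ℝ} (hf : Differentiable ℝ f)
    (hL : ∀ x y, ‖gradient f x - gradient f y‖ ≤ L * ‖x - y‖) (h0 : 0 < L) (hη : 0 < η)
    (hηL : η ≤ 1 / (4 * L)) (x m : E) :
    η / 2 * ‖gradient f x‖ ^ 2 + 3 / (8 * η) * ‖(x - η • m) - x‖ ^ 2 -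
      η / 2 * ‖gradient f x - m‖ ^ 2 ≤ f x - f (x - η • m) := by
  have h := le_quadratic_of_lipschitz_gradient hf hL x (-(η • m))
  rw [← sub_eq_add_neg, norm_neg, norm_smul, Real.norm_of_nonneg hη.le, inner_neg_right,
    inner_smul_right] at h
  have e : (x - η • m) - x = -(η • m) := by abel
  rw [e, norm_neg, norm_smul, Real.norm_of_nonneg hη.le, norm_sub_sq_real]
  -- Polarizing the inner product leaves `(η/2 - Lη²/2)‖m‖² ≥ (3η/8)‖m‖²`, which is `3/(8η)` times
  -- the squared step.
  have hm : η * L ≤ 1 / 4 := by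
    rw [le_div_iff₀ (by positivity)] at hηL
    linarith
  have e2 : 3 / (8 * η) * (η * ‖m‖) ^ 2 = 3 / 8 * η * ‖m‖ ^ 2 := by field_simp
  rw [e2]
  nlinarith [mul_le_mul_of_nonneg_right hm (mul_nonneg hη.le (sq_nonneg ‖m‖))]

end Hilbert

/-! ### Sums over periods -/

theorem sum_range_mul_eq (F : ℕ → ℝ) (K τ : ℕ) :
    ∑ t ∈ Finset.range (K * τ), F t =
      ∑ k ∈ Finset.range K, ∑ r ∈ Finset.range τ, F (k * τ + r) := by
  induction K with
  | zero => simp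
  | succ K ih => rw [Finset.sum_range_succ, ← ih, Nat.succ_mul, Finset.sum_range_add]

theorem sum_range_mul_ite (g : ℕ → ℝ) (K : ℕ) {τ : ℕ} (hτ : 0 < τ) :
    ∑ t ∈ Finset.range (K * τ), (if t % τ = 0 then g t else 0) =
      ∑ k ∈ Finset.range K, g (k * τ) := by
  rw [sum_range_mul_eq]
  refine Finset.sum_congr rfl fun k _ => ?_
  rw [Finset.sum_eq_single 0]
  · simp
  · intro r hr h0
    rw [if_neg]
    rw [Nat.mul_add_mod', Nat.mod_eq_of_lt (Finset.mem_range.1 hr)]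
    exact h0
  · intro h; exact absurd (Finset.mem_range.2 hτ) h

/-- Adding up the recursion telescopes. The term `(1 - β) * e n` is the unused end of the telescope
and carries the induction. -/
theorem sum_le_of_contraction {e d G : ℕ → ℝ} {β c s : ℝ} (h0 : e 0 ≤ G 0 + s)
    (hs : ∀ t, e (t + 1) ≤ (1 - β) * e t + c * d t + G (t + 1) + s) (n : ℕ) :
    β * ∑ t ∈ Finset.range (n + 1), e t + (1 - β) * e n ≤
      c * ∑ t ∈ Finset.range n, d t + ∑ t ∈ Finset.range (n + 1), G t + (n + 1) * s := by
  induction n with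
  | zero => simp; linarith
  | succ n ih =>
    rw [Finset.sum_range_succ e (n + 1), Finset.sum_range_succ d n, Finset.sum_range_succ G (n + 1)]
    have := hs n
    push_cast
    linarith

/-- The recursions for the expected squared gradient norms `g`, step lengths `d`, momentum errors
`e` and projection errors `a` combine to a bound on the sum of `g`. -/
theorem sum_le_of_recursions {g d e a : ℕ → ℝ} {β η δ L s N Δ : ℝ} {τ K : ℕ}
    (hg : ∀ t, 0 ≤ g t) (hd : ∀ t, 0 ≤ d t) (he : ∀ t, 0 ≤ e t)
    (hβ0 : 0 < β) (hβ1 : β ≤ 1) (hδ0 : 0 < δ) (hδ1 : δ ≤ 1) (hη : 0 < η)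
    (hτ : 0 < τ) (hK : 0 < K) (hτβ : 64 / (3 * β * δ) ≤ τ)
    (h1 : η ^ 2 * L ^ 2 ≤ 3 * δ * β ^ 2 / 80) (h2 : η ^ 2 * L ^ 2 * τ ^ 2 ≤ δ / 40)
    (h3 : η ^ 2 * L ^ 2 * τ ≤ 3 * β / 32)
    (desc : ∑ t ∈ Finset.range (K * τ),
      (η / 2 * g t + 3 / (8 * η) * d t - η / 2 * (e t + a t)) ≤ Δ)
    (mom0 : e 0 ≤ g 0 + β ^ 2 * s)
    (mom : ∀ t, e (t + 1) ≤ (1 - β) * e t + L ^ 2 / β * d t +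
      (if (t + 1) % τ = 0 then g (t + 1) else 0) + β ^ 2 * s)
    (capt : ∀ k, ∀ r < τ, a (k * τ + r) ≤ (1 - δ / 2) * g (k * τ + r) +
      16 / δ * (L ^ 2 * (τ * ∑ i ∈ Finset.range τ, d (k * τ + i)) + N))
    (drift : ∀ k, ∀ r < τ, g (k * τ) ≤ 2 * g (k * τ + r) +
      2 * L ^ 2 * (τ * ∑ i ∈ Finset.range τ, d (k * τ + i))) :
    η * δ / 8 * ∑ t ∈ Finset.range (K * τ), g t ≤
      Δ + η / 2 * ((16 / δ * N + β * s) * (K * τ)) := by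
  set Gs := ∑ t ∈ Finset.range (K * τ), g t with hGs
  set Ds := ∑ t ∈ Finset.range (K * τ), d t with hDs
  set Es := ∑ t ∈ Finset.range (K * τ), e t with hEs
  set As := ∑ t ∈ Finset.range (K * τ), a t with hAs
  have hGs0 : 0 ≤ Gs := Finset.sum_nonneg fun t _ => hg t
  have hDs0 : 0 ≤ Ds := Finset.sum_nonneg fun t _ => hd t
  have hτ' : (0 : ℝ) < τ := by exact_mod_cast hτ
  have desc' : η / 2 * Gs + 3 / (8 * η) * Ds - η / 2 * (Es + As) ≤ Δ := by
    rw [Finset.sum_sub_distrib, Finset.sum_add_distrib, ← Finset.mul_sum, ← Finset.mul_sum,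
      ← Finset.mul_sum, Finset.sum_add_distrib] at desc
    exact desc
  have hA : As ≤ (1 - δ / 2) * Gs + 16 / δ * (L ^ 2 * τ ^ 2 * Ds + N * (K * τ)) := by
    have : As ≤ ∑ k ∈ Finset.range K, ∑ r ∈ Finset.range τ, ((1 - δ / 2) * g (k * τ + r) +
      16 / δ * (L ^ 2 * (τ * ∑ i ∈ Finset.range τ, d (k * τ + i)) + N)) := by
      rw [hAs, sum_range_mul_eq]
      exact Finset.sum_le_sum fun k _ => Finset.sum_le_sum fun r hr =>
        capt k r (Finset.mem_range.1 hr)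
    refine this.trans_eq ?_
    rw [hGs, hDs, sum_range_mul_eq, sum_range_mul_eq]
    simp only [Finset.sum_add_distrib, Finset.sum_const, Finset.card_range, ← Finset.mul_sum,
      nsmul_eq_mul]
    ring
  -- Each switch gradient is compared with all `τ` gradients of its period, so the switch terms
  -- amount to about `2/τ` of the whole sum.
  have hS : τ * ∑ k ∈ Finset.range K, g (k * τ) ≤ 2 * Gs + 2 * L ^ 2 * τ ^ 2 * Ds := by
    have : ∑ k ∈ Finset.range K, ∑ _r ∈ Finset.range τ, g (k * τ) ≤
        ∑ k ∈ Finset.range K, ∑ r ∈ Finset.range τ, (2 * g (k * τ + r) +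
          2 * L ^ 2 * (τ * ∑ i ∈ Finset.range τ, d (k * τ + i))) :=
      Finset.sum_le_sum fun k _ => Finset.sum_le_sum fun r hr => drift k r (Finset.mem_range.1 hr)
    rw [hGs, hDs, sum_range_mul_eq, sum_range_mul_eq]
    simp only [Finset.sum_add_distrib, Finset.sum_const, Finset.card_range, ← Finset.mul_sum,
      nsmul_eq_mul] at this
    linarith
  have hE : β * Es ≤ L ^ 2 / β * Ds + ∑ k ∈ Finset.range K, g (k * τ) + K * τ * (β ^ 2 * s) := by
    obtain ⟨n, hn⟩ : ∃ n, K * τ = n + 1 := ⟨K * τ - 1, by have := Nat.mul_pos hK hτ; omega⟩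
    have := sum_le_of_contraction (G := fun t => if t % τ = 0 then g t else 0) (e := e)
      (β := β) (s := β ^ 2 * s) (c := L ^ 2 / β) (d := d) (by simpa using mom0) mom n
    rw [← hn, sum_range_mul_ite g K hτ] at this
    have hD' : ∑ t ∈ Finset.range n, d t ≤ Ds := by
      rw [hDs, hn, Finset.sum_range_succ]; linarith [hd n]
    have hn' : (n : ℝ) + 1 = K * τ := by exact_mod_cast hn.symm
    rw [hn'] at this
    have hc : 0 ≤ L ^ 2 / β := by positivity
    nlinarith [mul_nonneg (sub_nonneg.2 hβ1) (he n), mul_le_mul_of_nonneg_left hD' hc]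
  have hβτ : 64 ≤ 3 * β * δ * τ := by
    rw [div_le_iff₀ (by positivity)] at hτβ
    linarith
  have hE2 : Es ≤ L ^ 2 / β ^ 2 * Ds + 3 * δ / 32 * Gs + 2 * L ^ 2 * τ / β * Ds +
      β * s * (K * τ) := by
    have k1 : ∑ k ∈ Finset.range K, g (k * τ) ≤ (2 * Gs + 2 * L ^ 2 * τ ^ 2 * Ds) / τ := by
      rw [le_div_iff₀ hτ']; linarith
    have k2 : Es ≤ (L ^ 2 / β * Ds + (2 * Gs + 2 * L ^ 2 * τ ^ 2 * Ds) / τ +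
        K * τ * (β ^ 2 * s)) / β := by
      rw [le_div_iff₀ hβ0]; linarith
    have k3 : (L ^ 2 / β * Ds + (2 * Gs + 2 * L ^ 2 * τ ^ 2 * Ds) / τ +
        K * τ * (β ^ 2 * s)) / β = L ^ 2 / β ^ 2 * Ds + 2 / (β * τ) * Gs + 2 * L ^ 2 * τ / β * Ds +
      β * s * (K * τ) := by field_simp; ring
    -- This is where the lower bound on `τ` enters: the switches cost at most `3δ/32` of `Gs`.
    have k4 : 2 / (β * τ) ≤ 3 * δ / 32 := by
      rw [div_le_div_iff₀ (by positivity) (by norm_num)]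
      linarith
    have k5 := mul_le_mul_of_nonneg_right k4 hGs0
    linarith
  have c1 : η / 2 * (L ^ 2 / β ^ 2) ≤ 3 / 160 / η := by
    rw [le_div_iff₀ hη]
    have : η ^ 2 * L ^ 2 / β ^ 2 ≤ 3 / 80 := by
      rw [div_le_iff₀ (by positivity)]
      nlinarith [mul_le_mul_of_nonneg_right hδ1 (sq_nonneg β)]
    calc _ = η ^ 2 * L ^ 2 / β ^ 2 / 2 := by ring
      _ ≤ _ := by linarith
  have c2 : η / 2 * (16 / δ * (L ^ 2 * τ ^ 2)) ≤ 1 / 5 / η := by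
    rw [le_div_iff₀ hη]
    have : η ^ 2 * L ^ 2 * τ ^ 2 / δ ≤ 1 / 40 := by
      rw [div_le_iff₀ (by positivity)]; linarith
    calc _ = 8 * (η ^ 2 * L ^ 2 * τ ^ 2 / δ) := by ring
      _ ≤ _ := by linarith
  have c3 : η / 2 * (2 * L ^ 2 * τ / β) ≤ 3 / 32 / η := by
    rw [le_div_iff₀ hη]
    have : η ^ 2 * L ^ 2 * τ / β ≤ 3 / 32 := by
      rw [div_le_iff₀ (by positivity)]; linarith
    calc _ = η ^ 2 * L ^ 2 * τ / β := by ring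
      _ ≤ _ := by linarith
  -- The three step-size conditions each pay for one drift term, and `3/160 + 1/5 + 3/32 + 1/16 =
  -- 3/8` is exactly the available step-length budget, with `1/16` to spare.
  have c : η / 2 * (L ^ 2 / β ^ 2 + 16 / δ * (L ^ 2 * τ ^ 2) + 2 * L ^ 2 * τ / β) ≤
      3 / (8 * η) := by
    have : 3 / (8 * η) = 3 / 160 / η + 1 / 5 / η + 3 / 32 / η + 1 / 16 / η := by
      field_simp; norm_num
    have : (0 : ℝ) ≤ 1 / 16 / η := by positivity
    linarith
  have c' := mul_le_mul_of_nonneg_right c hDs0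
  have hEA := mul_le_mul_of_nonneg_left (add_le_add hE2 hA) (by positivity : 0 ≤ η / 2)
  have hgd : 0 ≤ η * δ * Gs := by positivity
  -- The coefficient of `Gs` is `η/2 * (1 - δ/2 + 3δ/32)`, so `13/64 ηδ` survives against the gain
  -- `η/2`; only `8/64` is needed.
  have hsplit : η / 2 * (L ^ 2 / β ^ 2 * Ds + 3 * δ / 32 * Gs + 2 * L ^ 2 * τ / β * Ds +
      β * s * (K * τ) + ((1 - δ / 2) * Gs + 16 / δ * (L ^ 2 * τ ^ 2 * Ds + N * (K * τ)))) =
      η / 2 * (L ^ 2 / β ^ 2 + 16 / δ * (L ^ 2 * τ ^ 2) + 2 * L ^ 2 * τ / β) * Ds +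
      (η / 2 * Gs - 13 / 64 * (η * δ * Gs)) + η / 2 * ((16 / δ * N + β * s) * (K * τ)) := by
    ring
  rw [hsplit] at hEA
  have hgoal : η * δ / 8 * Gs = 1 / 8 * (η * δ * Gs) := by ring
  rw [hgoal]
  linarith

/-! ### Square-integrability and elementary quadratic bounds -/

theorem integrable_norm_sq {Ω E : Type*} [MeasurableSpace Ω] [NormedAddCommGroup E]
    {μ : Measure Ω} {u : Ω → E} (hu : MemLp u 2 μ) :
    Integrable (fun ω => ‖u ω‖ ^ 2) μ :=
  hu.integrable_norm_pow two_ne_zero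

theorem integrable_inner_of_memLp {Ω E : Type*} [MeasurableSpace Ω] [NormedAddCommGroup E]
    [InnerProductSpace ℝ E] {μ : Measure Ω} {u v : Ω → E} (hu : MemLp u 2 μ) (hv : MemLp v 2 μ) :
    Integrable (fun ω => inner ℝ (u ω) (v ω)) μ := by
  refine ((integrable_norm_sq hu).add (integrable_norm_sq hv)).mono' (hu.1.inner hv.1)
    (Filter.Eventually.of_forall fun ω => ?_)
  have := norm_inner_le_norm (𝕜 := ℝ) (u ω) (v ω)
  simp only [Pi.add_apply]
  nlinarith [sq_nonneg (‖u ω‖ - ‖v ω‖), sq_nonneg (‖u ω‖ + ‖v ω‖)]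

/-- One factor `1 - β` pays for Young's inequality `(1 - β)(a + b)² ≤ a² + b²/β`; the other remains
as the contraction factor. No division by `1 - β` occurs, so `β = 1` is covered. -/
theorem norm_smul_add_sq_le {E : Type*} [NormedAddCommGroup E] {β : ℝ} (h0 : 0 < β) (h1 : β ≤ 1)
    (u v : E) :
    (1 - β) ^ 2 * ‖u + v‖ ^ 2 ≤ (1 - β) * ‖u‖ ^ 2 + 1 / β * ‖v‖ ^ 2 := by
  have h2 : ‖u + v‖ ^ 2 ≤ (‖u‖ + ‖v‖) ^ 2 := by gcongr; exact norm_add_le u v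
  have h3 : (1 - β) * (‖u‖ + ‖v‖) ^ 2 ≤ ‖u‖ ^ 2 + 1 / β * ‖v‖ ^ 2 := by
    have e : ‖u‖ ^ 2 + 1 / β * ‖v‖ ^ 2 - (1 - β) * (‖u‖ + ‖v‖) ^ 2 =
        (β * ‖u‖ - (1 - β) * ‖v‖) ^ 2 / β + ‖v‖ ^ 2 := by field_simp; ring
    have : 0 ≤ (β * ‖u‖ - (1 - β) * ‖v‖) ^ 2 / β + ‖v‖ ^ 2 := by positivity
    linarith
  have hb : 0 ≤ 1 - β := by linarith
  calc (1 - β) ^ 2 * ‖u + v‖ ^ 2 ≤ (1 - β) ^ 2 * (‖u‖ + ‖v‖) ^ 2 := by gcongr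
    _ = (1 - β) * ((1 - β) * (‖u‖ + ‖v‖) ^ 2) := by ring
    _ ≤ (1 - β) * (‖u‖ ^ 2 + 1 / β * ‖v‖ ^ 2) := by gcongr
    _ ≤ (1 - β) * ‖u‖ ^ 2 + 1 / β * ‖v‖ ^ 2 := by
      have : 0 ≤ β * (1 / β * ‖v‖ ^ 2) := by positivity
      linarith

theorem norm_add_sq_le_two {E : Type*} [NormedAddCommGroup E]
    (u v : E) : ‖u + v‖ ^ 2 ≤ 2 * ‖u‖ ^ 2 + 2 * ‖v‖ ^ 2 := by
  have h : ‖u + v‖ ^ 2 ≤ (‖u‖ + ‖v‖) ^ 2 := by gcongr; exact norm_add_le u v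
  nlinarith [sq_nonneg (‖u‖ - ‖v‖)]

/-! ### Projected momentum descent in a Hilbert space -/

section Iteration

variable {Ω E : Type*} [MeasurableSpace Ω] [NormedAddCommGroup E] [InnerProductSpace ℝ E]
  [CompleteSpace E]

/-- Momentum descent with random projections `p t`: `X t` is the iterate, `m t` the momentum before
iteration `t`, and `n t` the error of the gradient estimate of iteration `t`. -/
structure ProjectedMomentum (μ : Measure Ω) (f : E → ℝ) (x0 : E) (β η δ s N : ℝ) (τ : ℕ)
    (X m n : ℕ → Ω → E) (p : ℕ → Ω → E →ₗ[ℝ] E) : Prop where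
  X_zero : ∀ ω, X 0 ω = x0
  m_zero : ∀ ω, m 0 ω = 0
  p_zero : ∀ ω, p 0 ω = 0
  proj : ∀ t ω, (p t ω).IsSymmetricProjection
  X_succ : ∀ t ω, X (t + 1) ω = X t ω - η • m (t + 1) ω
  m_succ : ∀ t ω, m (t + 1) ω =
    p (t + 1) ω ((1 - β) • m t ω + β • (gradient f (X t ω) + n t ω))
  p_succ : ∀ t ω, t % τ ≠ 0 → p (t + 1) ω = p t ω
  capture : ∀ t ω, t % τ = 0 →
    ‖(gradient f (X t ω) + n t ω) - p (t + 1) ω (gradient f (X t ω) + n t ω)‖ ^ 2 ≤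
      (1 - δ) * ‖gradient f (X t ω) + n t ω‖ ^ 2
  aestronglyMeasurable_apply : ∀ t (v : Ω → E), AEStronglyMeasurable v μ →
    AEStronglyMeasurable (fun ω => p t ω (v ω)) μ
  memLp_noise : ∀ t, MemLp (n t) 2 μ
  noise_le : ∀ t, ∫ ω, ‖n t ω‖ ^ 2 ∂μ ≤ s
  noise_le_of_switch : ∀ t, t % τ = 0 → ∫ ω, ‖n t ω‖ ^ 2 ∂μ ≤ N
  -- Square integrability of the left factor is a premise of both orthogonality fields because it is
  -- deduced from the other fields only afterwards, in `memLp`. At a switch the left factor is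
  -- unprojected, so that it does not involve the projection chosen from the noise.
  orth_of_switch : ∀ t, t % τ = 0 → MemLp (fun ω => m t ω - gradient f (X t ω)) 2 μ →
    ∫ ω, inner ℝ (m t ω - gradient f (X t ω)) (n t ω) ∂μ = 0
  orth : ∀ t, t % τ ≠ 0 → MemLp (fun ω => m t ω - p t ω (gradient f (X t ω))) 2 μ →
    ∫ ω, inner ℝ (m t ω - p t ω (gradient f (X t ω))) (n t ω) ∂μ = 0

namespace ProjectedMomentum

variable {μ : Measure Ω} {f : E → ℝ} {x0 : E} {β η δ s N L : ℝ} {τ : ℕ}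
  {X m n : ℕ → Ω → E} {p : ℕ → Ω → E →ₗ[ℝ] E}

theorem apply_m (h : ProjectedMomentum μ f x0 β η δ s N τ X m n p) (t : ℕ) (ω : Ω) :
    p t ω (m t ω) = m t ω := by
  cases t with
  | zero => rw [h.m_zero, map_zero]
  | succ t => rw [h.m_succ, apply_apply_of_projection (h.proj _ _)]

theorem memLp_apply (h : ProjectedMomentum μ f x0 β η δ s N τ X m n p) (t : ℕ) {v : Ω → E}
    (hv : MemLp v 2 μ) : MemLp (fun ω => p t ω (v ω)) 2 μ :=
  hv.mono (h.aestronglyMeasurable_apply t v hv.1)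
    (Filter.Eventually.of_forall fun _ => norm_apply_le_of_projection (h.proj _ _) _)

theorem memLp_gradient [IsProbabilityMeasure μ]
    (hL : ∀ x y, ‖gradient f x - gradient f y‖ ≤ L * ‖x - y‖)
    {Y : Ω → E} (hY : MemLp Y 2 μ) : MemLp (fun ω => gradient f (Y ω)) 2 μ := by
  have hc := continuous_gradient_of_lipschitz hL
  have hd : MemLp (fun ω => gradient f (Y ω) - gradient f 0) 2 μ :=
    MemLp.of_le_mul (c := L) hY
      ((hc.comp_aestronglyMeasurable hY.1).sub aestronglyMeasurable_const)
      (Filter.Eventually.of_forall fun ω => by simpa using hL (Y ω) 0)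
  refine (hd.add (memLp_const (gradient f 0))).ae_eq (Filter.Eventually.of_forall fun ω => ?_)
  simp

theorem memLp [IsProbabilityMeasure μ] (h : ProjectedMomentum μ f x0 β η δ s N τ X m n p)
    (hL : ∀ x y, ‖gradient f x - gradient f y‖ ≤ L * ‖x - y‖) (t : ℕ) :
    MemLp (X t) 2 μ ∧ MemLp (m t) 2 μ := by
  induction t with
  | zero =>
    have e1 : X 0 = fun _ => x0 := funext h.X_zero
    have e2 : m 0 = fun _ => 0 := funext h.m_zero
    rw [e1, e2]
    exact ⟨memLp_const _, memLp_const _⟩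
  | succ t ih =>
    have e1 : X (t + 1) = fun ω => X t ω - η • m (t + 1) ω := funext (h.X_succ t)
    have e2 := funext (h.m_succ t)
    have hm : MemLp (m (t + 1)) 2 μ := by
      rw [e2]
      exact h.memLp_apply _ ((ih.2.const_smul (1 - β)).add
        (((memLp_gradient hL ih.1).add (h.memLp_noise t)).const_smul β))
    refine ⟨?_, hm⟩
    rw [e1]
    exact ih.1.sub (hm.const_smul η)

theorem memLp_grad [IsProbabilityMeasure μ] (h : ProjectedMomentum μ f x0 β η δ s N τ X m n p)
    (hL : ∀ x y, ‖gradient f x - gradient f y‖ ≤ L * ‖x - y‖) (t : ℕ) :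
    MemLp (fun ω => gradient f (X t ω)) 2 μ :=
  memLp_gradient hL (h.memLp hL t).1

/-- The integrated and telescoped `descent_step`. The loss `‖∇f - m‖²` is split by Pythagoras, as `m
(t + 1)` lies in the range of `p (t + 1)`. -/
theorem sum_descent_le [IsProbabilityMeasure μ] (h : ProjectedMomentum μ f x0 β η δ s N τ X m n p)
    (hf : Differentiable ℝ f) (hb : BddBelow (Set.range f))
    (hL : ∀ x y, ‖gradient f x - gradient f y‖ ≤ L * ‖x - y‖) (h0 : 0 < L) (hη : 0 < η)
    (hηL : η ≤ 1 / (4 * L)) (T : ℕ) :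
    ∑ t ∈ Finset.range T, (η / 2 * ∫ ω, ‖gradient f (X t ω)‖ ^ 2 ∂μ +
      3 / (8 * η) * ∫ ω, ‖X (t + 1) ω - X t ω‖ ^ 2 ∂μ -
      η / 2 * (∫ ω, ‖m (t + 1) ω - p (t + 1) ω (gradient f (X t ω))‖ ^ 2 ∂μ +
        ∫ ω, ‖gradient f (X t ω) - p (t + 1) ω (gradient f (X t ω))‖ ^ 2 ∂μ)) ≤
      f x0 - ⨅ x, f x := by
  have i1 : ∀ t, Integrable (fun ω => η / 2 * ‖gradient f (X t ω)‖ ^ 2) μ := fun t =>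
    (integrable_norm_sq (h.memLp_grad hL t)).const_mul _
  have i2 : ∀ t, Integrable (fun ω => 3 / (8 * η) * ‖X (t + 1) ω - X t ω‖ ^ 2) μ := fun t =>
    (integrable_norm_sq ((h.memLp hL (t + 1)).1.sub (h.memLp hL t).1)).const_mul _
  have i3 : ∀ t, Integrable
      (fun ω => ‖m (t + 1) ω - p (t + 1) ω (gradient f (X t ω))‖ ^ 2) μ := fun t =>
    integrable_norm_sq ((h.memLp hL (t + 1)).2.sub (h.memLp_apply _ (h.memLp_grad hL t)))
  have i4 : ∀ t, Integrable
      (fun ω => ‖gradient f (X t ω) - p (t + 1) ω (gradient f (X t ω))‖ ^ 2) μ := fun t =>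
    integrable_norm_sq ((h.memLp_grad hL t).sub (h.memLp_apply _ (h.memLp_grad hL t)))
  have i5 : ∀ t, Integrable (fun ω =>
      η / 2 * (‖m (t + 1) ω - p (t + 1) ω (gradient f (X t ω))‖ ^ 2 +
        ‖gradient f (X t ω) - p (t + 1) ω (gradient f (X t ω))‖ ^ 2)) μ := fun t =>
    ((i3 t).add (i4 t)).const_mul _
  have i6 : ∀ t, Integrable (fun ω => η / 2 * ‖gradient f (X t ω)‖ ^ 2 +
      3 / (8 * η) * ‖X (t + 1) ω - X t ω‖ ^ 2 -
      η / 2 * (‖m (t + 1) ω - p (t + 1) ω (gradient f (X t ω))‖ ^ 2 +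
        ‖gradient f (X t ω) - p (t + 1) ω (gradient f (X t ω))‖ ^ 2)) μ := fun t =>
    ((i1 t).add (i2 t)).sub (i5 t)
  have e : ∀ t, η / 2 * ∫ ω, ‖gradient f (X t ω)‖ ^ 2 ∂μ +
      3 / (8 * η) * ∫ ω, ‖X (t + 1) ω - X t ω‖ ^ 2 ∂μ -
      η / 2 * (∫ ω, ‖m (t + 1) ω - p (t + 1) ω (gradient f (X t ω))‖ ^ 2 ∂μ +
        ∫ ω, ‖gradient f (X t ω) - p (t + 1) ω (gradient f (X t ω))‖ ^ 2 ∂μ) =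
      ∫ ω, (η / 2 * ‖gradient f (X t ω)‖ ^ 2 +
      3 / (8 * η) * ‖X (t + 1) ω - X t ω‖ ^ 2 -
      η / 2 * (‖m (t + 1) ω - p (t + 1) ω (gradient f (X t ω))‖ ^ 2 +
        ‖gradient f (X t ω) - p (t + 1) ω (gradient f (X t ω))‖ ^ 2)) ∂μ := by
    intro t
    rw [integral_sub (f := fun ω => η / 2 * ‖gradient f (X t ω)‖ ^ 2 +
      3 / (8 * η) * ‖X (t + 1) ω - X t ω‖ ^ 2) ((i1 t).add (i2 t)) (i5 t),
      integral_add (i1 t) (i2 t), integral_const_mul, integral_const_mul, integral_const_mul,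
      integral_add (i3 t) (i4 t)]
  simp_rw [e]
  rw [← integral_finsetSum _ fun t _ => i6 t]
  refine (integral_mono (integrable_finsetSum _ fun t _ => i6 t)
    (integrable_const (f x0 - ⨅ x, f x)) fun ω => ?_).trans_eq (by simp)
  have step : ∀ t, η / 2 * ‖gradient f (X t ω)‖ ^ 2 +
      3 / (8 * η) * ‖X (t + 1) ω - X t ω‖ ^ 2 -
      η / 2 * (‖m (t + 1) ω - p (t + 1) ω (gradient f (X t ω))‖ ^ 2 +
        ‖gradient f (X t ω) - p (t + 1) ω (gradient f (X t ω))‖ ^ 2) ≤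
        f (X t ω) - f (X (t + 1) ω) := by
    intro t
    rw [← norm_sub_sq_of_projection (h.proj _ _) (h.apply_m (t + 1) ω), h.X_succ]
    exact descent_step hf hL h0 hη hηL _ _
  calc _ ≤ ∑ t ∈ Finset.range T, (f (X t ω) - f (X (t + 1) ω)) :=
        Finset.sum_le_sum fun t _ => step t
    _ = f x0 - f (X T ω) := by rw [Finset.sum_range_sub', h.X_zero]
    _ ≤ _ := sub_le_sub_left (ciInf_le hb _) _

/-- Common end of both cases of `momentum_error_le`: the cross term integrates to zero, so the noise
enters only with the factor `β²`. -/
theorem momentum_error_le_of_orth (h : ProjectedMomentum μ f x0 β η δ s N τ X m n p)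
    {q Y : Ω → E} {t : ℕ} (hY : MemLp Y 2 μ) (hq : MemLp q 2 μ)
    (hqY : ∀ ω, ‖q ω‖ ^ 2 ≤
      (1 - β) ^ 2 * ‖Y ω‖ ^ 2 + 2 * ((1 - β) * β) * inner ℝ (Y ω) (n t ω) + β ^ 2 * ‖n t ω‖ ^ 2)
    (ho : ∫ ω, inner ℝ (Y ω) (n t ω) ∂μ = 0) :
    ∫ ω, ‖q ω‖ ^ 2 ∂μ ≤ (1 - β) ^ 2 * ∫ ω, ‖Y ω‖ ^ 2 ∂μ + β ^ 2 * s := by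
  have i1 := (integrable_norm_sq hY).const_mul ((1 - β) ^ 2)
  have i2 : Integrable (fun ω => 2 * ((1 - β) * β) * inner ℝ (Y ω) (n t ω)) μ :=
    (integrable_inner_of_memLp hY (h.memLp_noise t)).const_mul (2 * ((1 - β) * β))
  have i3 := (integrable_norm_sq (h.memLp_noise t)).const_mul (β ^ 2)
  refine (integral_mono (integrable_norm_sq hq) ((i1.add i2).add i3) hqY).trans ?_
  rw [integral_add' (i1.add i2) i3, integral_add' i1 i2, integral_const_mul, integral_const_mul,
    integral_const_mul, ho, mul_zero, add_zero]
  have := mul_le_mul_of_nonneg_left (h.noise_le t) (sq_nonneg β)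
  linarith

theorem momentum_error_le [IsProbabilityMeasure μ]
    (h : ProjectedMomentum μ f x0 β η δ s N τ X m n p)
    (hL : ∀ x y, ‖gradient f x - gradient f y‖ ≤ L * ‖x - y‖)
    (hβ0 : 0 < β) (hβ1 : β ≤ 1) (t : ℕ) :
    ∫ ω, ‖m (t + 1) ω - p (t + 1) ω (gradient f (X t ω))‖ ^ 2 ∂μ ≤
      (1 - β) ^ 2 * ∫ ω, ‖m t ω - p t ω (gradient f (X t ω))‖ ^ 2 ∂μ +
      (if t % τ = 0 then ∫ ω, ‖gradient f (X t ω)‖ ^ 2 ∂μ else 0) + β ^ 2 * s := by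
  have hG := h.memLp_grad hL t
  have hm := (h.memLp hL t).2
  have hq : MemLp (fun ω => m (t + 1) ω - p (t + 1) ω (gradient f (X t ω))) 2 μ :=
    (h.memLp hL (t + 1)).2.sub (h.memLp_apply _ hG)
  split_ifs with hs
  -- At a switch `p (t + 1)` depends on `n t`, so it is dropped by nonexpansiveness before taking
  -- expectations. The remaining vector `m t - ∇f` was fixed before the noise was drawn.
  · have hY : MemLp (fun ω => m t ω - gradient f (X t ω)) 2 μ := hm.sub hG
    refine (h.momentum_error_le_of_orth hY hq (fun ω => ?_) (h.orth_of_switch t hs hY)).trans ?_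
    · have e : m (t + 1) ω - p (t + 1) ω (gradient f (X t ω)) =
          p (t + 1) ω ((1 - β) • (m t ω - gradient f (X t ω)) + β • n t ω) := by
        rw [h.m_succ, ← map_sub]
        congr 1
        module
      rw [e]
      refine (pow_le_pow_left₀ (norm_nonneg _)
        (norm_apply_le_of_projection (h.proj _ _) _) 2).trans_eq ?_
      rw [norm_add_sq_real, norm_smul, norm_smul, inner_smul_left, inner_smul_right, mul_pow,
        mul_pow, Real.norm_eq_abs, Real.norm_eq_abs, sq_abs, sq_abs]
      simp
      ring
    -- Pythagoras for the old subspace: the part of the gradient outside it is the cost of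
    -- switching, bounded by the full gradient.
    · have hle : ∫ ω, ‖m t ω - gradient f (X t ω)‖ ^ 2 ∂μ ≤
          ∫ ω, ‖m t ω - p t ω (gradient f (X t ω))‖ ^ 2 ∂μ + ∫ ω, ‖gradient f (X t ω)‖ ^ 2 ∂μ := by
        have i1 : Integrable (fun ω => ‖m t ω - p t ω (gradient f (X t ω))‖ ^ 2) μ :=
          integrable_norm_sq (hm.sub (h.memLp_apply t hG))
        rw [← integral_add i1 (integrable_norm_sq hG)]
        refine integral_mono (integrable_norm_sq hY) (i1.add (integrable_norm_sq hG)) fun ω => ?_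
        have e := norm_sub_sq_of_projection (h.proj t ω) (h.apply_m t ω) (gradient f (X t ω))
        have e2 := norm_sub_apply_le_of_projection (h.proj t ω) (gradient f (X t ω))
        have e3 := pow_le_pow_left₀ (norm_nonneg _) e2 2
        beta_reduce
        rw [norm_sub_rev, e]
        linarith
      have h1 : (1 - β) ^ 2 ≤ 1 := by nlinarith
      have h2 : 0 ≤ ∫ ω, ‖gradient f (X t ω)‖ ^ 2 ∂μ := integral_nonneg fun _ => sq_nonneg _
      nlinarith [mul_le_mul_of_nonneg_left hle (sq_nonneg (1 - β)),
        mul_le_mul_of_nonneg_right h1 h2]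
  · have hY : MemLp (fun ω => m t ω - p t ω (gradient f (X t ω))) 2 μ :=
      hm.sub (h.memLp_apply t hG)
    refine (h.momentum_error_le_of_orth hY hq (fun ω => ?_) (h.orth t hs hY)).trans (by simp)
    have hp := h.p_succ t ω hs
    have e : m (t + 1) ω - p (t + 1) ω (gradient f (X t ω)) =
        (1 - β) • (m t ω - p t ω (gradient f (X t ω))) + β • p t ω (n t ω) := by
      rw [h.m_succ, hp, map_add, map_smul, map_smul, map_add, h.apply_m]
      module
    -- Between switches the projection was fixed before the noise. By symmetry it can be moved to
    -- the left factor, which it leaves unchanged.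
    have hin : inner ℝ (m t ω - p t ω (gradient f (X t ω))) (p t ω (n t ω)) =
        inner ℝ (m t ω - p t ω (gradient f (X t ω))) (n t ω) := by
      rw [← (h.proj t ω).isSymmetric, map_sub, h.apply_m, apply_apply_of_projection (h.proj t ω)]
    rw [e, norm_add_sq_real, norm_smul, norm_smul, inner_smul_left, inner_smul_right, hin, mul_pow,
      mul_pow, Real.norm_eq_abs, Real.norm_eq_abs, sq_abs, sq_abs]
    have e3 := pow_le_pow_left₀ (norm_nonneg _)
      (norm_apply_le_of_projection (h.proj t ω) (n t ω)) 2
    have := mul_le_mul_of_nonneg_left e3 (sq_nonneg β)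
    simp
    nlinarith

/-- `momentum_error_le` at `t + 1` measures the old momentum against the gradient at `X (t + 1)`;
moving back to `X t` closes the recursion. It costs one factor `1 - β` and a multiple of the squared
step. -/
theorem lagged_error_le [IsProbabilityMeasure μ] (h : ProjectedMomentum μ f x0 β η δ s N τ X m n p)
    (hL : ∀ x y, ‖gradient f x - gradient f y‖ ≤ L * ‖x - y‖)
    (hβ0 : 0 < β) (hβ1 : β ≤ 1) (t : ℕ) :
    (1 - β) ^ 2 * ∫ ω, ‖m (t + 1) ω - p (t + 1) ω (gradient f (X (t + 1) ω))‖ ^ 2 ∂μ ≤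
      (1 - β) * ∫ ω, ‖m (t + 1) ω - p (t + 1) ω (gradient f (X t ω))‖ ^ 2 ∂μ +
      L ^ 2 / β * ∫ ω, ‖X (t + 1) ω - X t ω‖ ^ 2 ∂μ := by
  have hm := (h.memLp hL (t + 1)).2
  have i1 := (integrable_norm_sq
    (hm.sub (h.memLp_apply (t + 1) (h.memLp_grad hL (t + 1))))).const_mul ((1 - β) ^ 2)
  have i2 := (integrable_norm_sq
    (hm.sub (h.memLp_apply (t + 1) (h.memLp_grad hL t)))).const_mul (1 - β)
  have i3 := (integrable_norm_sq
    ((h.memLp hL (t + 1)).1.sub (h.memLp hL t).1)).const_mul (L ^ 2 / β)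
  rw [← integral_const_mul, ← integral_const_mul, ← integral_const_mul]
  refine (integral_mono i1 (i2.add i3) fun ω => ?_).trans_eq (integral_add i2 i3)
  have e : m (t + 1) ω - p (t + 1) ω (gradient f (X (t + 1) ω)) =
      (m (t + 1) ω - p (t + 1) ω (gradient f (X t ω))) +
        p (t + 1) ω (gradient f (X t ω) - gradient f (X (t + 1) ω)) := by
    rw [map_sub]; abel
  have e1 := norm_smul_add_sq_le hβ0 hβ1 (m (t + 1) ω - p (t + 1) ω (gradient f (X t ω)))
    (p (t + 1) ω (gradient f (X t ω) - gradient f (X (t + 1) ω)))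
  have e2 : ‖p (t + 1) ω (gradient f (X t ω) - gradient f (X (t + 1) ω))‖ ≤
      L * ‖X (t + 1) ω - X t ω‖ := by
    refine (norm_apply_le_of_projection (h.proj _ _) _).trans ?_
    rw [norm_sub_rev]
    exact hL _ _
  have e3 := pow_le_pow_left₀ (norm_nonneg _) e2 2
  have e4 := mul_le_mul_of_nonneg_left e3 (by positivity : 0 ≤ 1 / β)
  simp only [Pi.add_apply, Pi.sub_apply]
  rw [e]
  refine e1.trans ?_
  have : 1 / β * (L * ‖X (t + 1) ω - X t ω‖) ^ 2 = L ^ 2 / β * ‖X (t + 1) ω - X t ω‖ ^ 2 := by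
    ring
  linarith

/-- Cauchy–Schwarz on the telescoped displacement, enlarged to the whole period so that the bound
does not depend on `r`. -/
theorem drift_le [IsProbabilityMeasure μ] (h : ProjectedMomentum μ f x0 β η δ s N τ X m n p)
    (hL : ∀ x y, ‖gradient f x - gradient f y‖ ≤ L * ‖x - y‖) (t : ℕ) {r : ℕ} (hr : r < τ) :
    ∫ ω, ‖X (t + r) ω - X t ω‖ ^ 2 ∂μ ≤
      τ * ∑ i ∈ Finset.range τ, ∫ ω, ‖X (t + i + 1) ω - X (t + i) ω‖ ^ 2 ∂μ := by
  have i1 : ∀ i, Integrable (fun ω => ‖X (t + i + 1) ω - X (t + i) ω‖ ^ 2) μ := fun i =>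
    integrable_norm_sq ((h.memLp hL (t + i + 1)).1.sub (h.memLp hL (t + i)).1)
  rw [← integral_finsetSum _ fun i _ => i1 i, ← integral_const_mul]
  refine integral_mono (integrable_norm_sq ((h.memLp hL (t + r)).1.sub (h.memLp hL t).1))
    ((integrable_finsetSum _ fun i _ => i1 i).const_mul _) fun ω => ?_
  have e : X (t + r) ω - X t ω =
      ∑ i ∈ Finset.range r, (X (t + i + 1) ω - X (t + i) ω) := by
    have := Finset.sum_range_sub (fun i => X (t + i) ω) r
    simpa [add_assoc] using this.symm
  beta_reduce
  rw [e]
  calc ‖∑ i ∈ Finset.range r, (X (t + i + 1) ω - X (t + i) ω)‖ ^ 2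
      ≤ (∑ i ∈ Finset.range r, ‖X (t + i + 1) ω - X (t + i) ω‖) ^ 2 := by
        gcongr; exact norm_sum_le _ _
    _ ≤ (Finset.range r).card * ∑ i ∈ Finset.range r, ‖X (t + i + 1) ω - X (t + i) ω‖ ^ 2 :=
        sq_sum_le_card_mul_sum_sq
    _ ≤ τ * ∑ i ∈ Finset.range τ, ‖X (t + i + 1) ω - X (t + i) ω‖ ^ 2 := by
        rw [Finset.card_range]
        gcongr

theorem gradient_drift_le [IsProbabilityMeasure μ]
    (h : ProjectedMomentum μ f x0 β η δ s N τ X m n p)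
    (hL : ∀ x y, ‖gradient f x - gradient f y‖ ≤ L * ‖x - y‖) (t : ℕ) {r : ℕ} (hr : r < τ) :
    ∫ ω, ‖gradient f (X (t + r) ω) - gradient f (X t ω)‖ ^ 2 ∂μ ≤
      L ^ 2 * (τ * ∑ i ∈ Finset.range τ, ∫ ω, ‖X (t + i + 1) ω - X (t + i) ω‖ ^ 2 ∂μ) := by
  refine le_trans ?_ (mul_le_mul_of_nonneg_left (h.drift_le hL t hr) (sq_nonneg L))
  rw [← integral_const_mul]
  refine integral_mono
    (integrable_norm_sq ((h.memLp_grad hL (t + r)).sub (h.memLp_grad hL t)))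
    ((integrable_norm_sq ((h.memLp hL (t + r)).1.sub (h.memLp hL t).1)).const_mul _) fun ω => ?_
  beta_reduce
  rw [← mul_pow]
  exact pow_le_pow_left₀ (norm_nonneg _) (hL _ _) 2

theorem p_add (h : ProjectedMomentum μ f x0 β η δ s N τ X m n p) {t : ℕ} (ht : t % τ = 0)
    {r : ℕ} (hr : r < τ) (ω : Ω) : p (t + r + 1) ω = p (t + 1) ω := by
  induction r with
  | zero => rfl
  | succ r ih =>
    rw [← ih (by omega)]
    refine h.p_succ (t + (r + 1)) ω ?_
    rw [Nat.add_mod, ht, zero_add, Nat.mod_mod, Nat.mod_eq_of_lt hr]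
    omega

/-- The subspace captured the noisy gradient `w` at the switch `t` and is kept during the period.
The distance from the present gradient to `w` consists of drift and batch noise; squaring the sum
doubles `8/δ` to `16/δ`. -/
theorem projection_error_le [IsProbabilityMeasure μ]
    (h : ProjectedMomentum μ f x0 β η δ s N τ X m n p)
    (hL : ∀ x y, ‖gradient f x - gradient f y‖ ≤ L * ‖x - y‖) (hδ0 : 0 < δ) (hδ1 : δ ≤ 1)
    {t : ℕ} (ht : t % τ = 0) {r : ℕ} (hr : r < τ) :
    ∫ ω, ‖gradient f (X (t + r) ω) - p (t + r + 1) ω (gradient f (X (t + r) ω))‖ ^ 2 ∂μ ≤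
      (1 - δ / 2) * ∫ ω, ‖gradient f (X (t + r) ω)‖ ^ 2 ∂μ + 16 / δ *
      (L ^ 2 * (τ * ∑ i ∈ Finset.range τ, ∫ ω, ‖X (t + i + 1) ω - X (t + i) ω‖ ^ 2 ∂μ) + N) := by
  have hG := h.memLp_grad hL (t + r)
  have i0 := integrable_norm_sq (hG.sub (h.memLp_apply (t + r + 1) hG))
  have i1 := (integrable_norm_sq hG).const_mul (1 - δ / 2)
  have i2 := integrable_norm_sq (hG.sub (h.memLp_grad hL t))
  have i3 := integrable_norm_sq (h.memLp_noise t)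
  have i4 := (i2.add i3).const_mul (16 / δ)
  have key : ∫ ω, ‖gradient f (X (t + r) ω) -
      p (t + r + 1) ω (gradient f (X (t + r) ω))‖ ^ 2 ∂μ ≤
      (1 - δ / 2) * ∫ ω, ‖gradient f (X (t + r) ω)‖ ^ 2 ∂μ + 16 / δ *
      (∫ ω, ‖gradient f (X (t + r) ω) - gradient f (X t ω)‖ ^ 2 ∂μ + ∫ ω, ‖n t ω‖ ^ 2 ∂μ) := by
    refine (integral_mono i0 (i1.add i4) fun ω => ?_).trans_eq ?_
    · simp only [Pi.sub_apply, Pi.add_apply]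
      rw [h.p_add ht hr]
      refine (norm_sub_apply_sq_le_of_capture (h.proj _ _) hδ0 hδ1 (h.capture t ω ht) _).trans ?_
      have e := norm_add_sq_le_two (gradient f (X (t + r) ω) - gradient f (X t ω)) (-n t ω)
      rw [norm_neg] at e
      have e2 : gradient f (X (t + r) ω) - (gradient f (X t ω) + n t ω) =
          gradient f (X (t + r) ω) - gradient f (X t ω) + -n t ω := by abel
      rw [e2]
      have e3 := mul_le_mul_of_nonneg_left e (by positivity : 0 ≤ 8 / δ)
      have e4 : (16 : ℝ) / δ = 8 / δ * 2 := by ring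
      rw [e4]
      linarith
    · rw [integral_add' i1 i4, integral_const_mul, integral_const_mul, integral_add' i2 i3]
      rfl
  refine key.trans ?_
  gcongr
  · exact h.gradient_drift_le hL t hr
  · exact h.noise_le_of_switch t ht

/-- Allows the gradient charged at a switch to be spread over all iterations of its period. -/
theorem switch_gradient_le [IsProbabilityMeasure μ]
    (h : ProjectedMomentum μ f x0 β η δ s N τ X m n p)
    (hL : ∀ x y, ‖gradient f x - gradient f y‖ ≤ L * ‖x - y‖)
    (t : ℕ) {r : ℕ} (hr : r < τ) :
    ∫ ω, ‖gradient f (X t ω)‖ ^ 2 ∂μ ≤ 2 * ∫ ω, ‖gradient f (X (t + r) ω)‖ ^ 2 ∂μ + 2 * L ^ 2 *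
      (τ * ∑ i ∈ Finset.range τ, ∫ ω, ‖X (t + i + 1) ω - X (t + i) ω‖ ^ 2 ∂μ) := by
  have i1 := (integrable_norm_sq (h.memLp_grad hL (t + r))).const_mul 2
  have i2 := (integrable_norm_sq
    ((h.memLp_grad hL (t + r)).sub (h.memLp_grad hL t))).const_mul 2
  have key : ∫ ω, ‖gradient f (X t ω)‖ ^ 2 ∂μ ≤ 2 * ∫ ω, ‖gradient f (X (t + r) ω)‖ ^ 2 ∂μ +
      2 * ∫ ω, ‖gradient f (X (t + r) ω) - gradient f (X t ω)‖ ^ 2 ∂μ := by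
    rw [← integral_const_mul, ← integral_const_mul]
    refine (integral_mono (integrable_norm_sq (h.memLp_grad hL t)) (i1.add i2)
      fun ω => ?_).trans_eq (integral_add' i1 i2)
    have e := norm_add_sq_le_two (gradient f (X (t + r) ω))
      (-(gradient f (X (t + r) ω) - gradient f (X t ω)))
    rw [norm_neg] at e
    simp only [Pi.sub_apply, Pi.add_apply]
    have e2 : gradient f (X (t + r) ω) + -(gradient f (X (t + r) ω) - gradient f (X t ω)) =
        gradient f (X t ω) := by abel
    rwa [e2] at e
  have := h.gradient_drift_le hL t hr
  linarith

/-- The sum of the expected squared gradient norms over `K` periods. -/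
theorem sum_gradient_le [IsProbabilityMeasure μ] (h : ProjectedMomentum μ f x0 β η δ s N τ X m n p)
    (hf : Differentiable ℝ f) (hb : BddBelow (Set.range f))
    (hL : ∀ x y, ‖gradient f x - gradient f y‖ ≤ L * ‖x - y‖) (h0 : 0 < L)
    (hβ0 : 0 < β) (hβ1 : β ≤ 1) (hδ0 : 0 < δ) (hδ1 : δ ≤ 1) (hη : 0 < η)
    (hτ : 0 < τ) (hτβ : 64 / (3 * β * δ) ≤ τ) (hηL : η ≤ 1 / (4 * L))
    (h1 : η ^ 2 * L ^ 2 ≤ 3 * δ * β ^ 2 / 80) (h2 : η ^ 2 * L ^ 2 * τ ^ 2 ≤ δ / 40)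
    (h3 : η ^ 2 * L ^ 2 * τ ≤ 3 * β / 32) {K : ℕ} (hK : 0 < K) :
    η * δ / 8 * ∑ t ∈ Finset.range (K * τ), ∫ ω, ‖gradient f (X t ω)‖ ^ 2 ∂μ ≤
      (f x0 - ⨅ x, f x) + η / 2 * ((16 / δ * N + β * s) * (K * τ)) := by
  refine sum_le_of_recursions
    (d := fun t => ∫ ω, ‖X (t + 1) ω - X t ω‖ ^ 2 ∂μ)
    (e := fun t => ∫ ω, ‖m (t + 1) ω - p (t + 1) ω (gradient f (X t ω))‖ ^ 2 ∂μ)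
    (a := fun t => ∫ ω, ‖gradient f (X t ω) - p (t + 1) ω (gradient f (X t ω))‖ ^ 2 ∂μ)
    (fun _ => integral_nonneg fun _ => sq_nonneg _) (fun _ => integral_nonneg fun _ => sq_nonneg _)
    (fun _ => integral_nonneg fun _ => sq_nonneg _) hβ0 hβ1 hδ0 hδ1 hη hτ hK hτβ h1 h2 h3
    (h.sum_descent_le hf hb hL h0 hη hηL _) ?_ (fun t => ?_) (fun k r hr => ?_) (fun k r hr => ?_)
  -- With `m 0 = 0` and `p 0 = 0` there is no earlier error, and `0` counts as a switch.
  · have := h.momentum_error_le hL hβ0 hβ1 0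
    simpa [h.m_zero, h.p_zero] using this
  · have e1 := h.momentum_error_le hL hβ0 hβ1 (t + 1)
    have e2 := h.lagged_error_le hL hβ0 hβ1 t
    linarith
  · exact h.projection_error_le hL hδ0 hδ1 (Nat.mul_mod_left k τ) hr
  · exact h.switch_gradient_le hL (k * τ) hr

end ProjectedMomentum

end Iteration

/-! ### The leading singular vectors -/

open Matrix in
theorem frobSq_eq_trace {m n : ℕ} (G : Matrix (Fin m) (Fin n) ℝ) : frobSq G = (Gᵀ * G).trace := by
  simp only [frobSq, Matrix.trace, Matrix.diag, Matrix.mul_apply, Matrix.transpose_apply, ← sq]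
  exact Finset.sum_comm

open Matrix in
theorem frobSq_transpose {m n : ℕ} (G : Matrix (Fin m) (Fin n) ℝ) : frobSq Gᵀ = frobSq G :=
  Finset.sum_comm

open Matrix in
theorem frobSq_mul_mul_transpose {m n : ℕ} {U : Matrix (Fin m) (Fin m) ℝ}
    {V : Matrix (Fin n) (Fin n) ℝ} (hU : Uᵀ * U = 1) (hV : Vᵀ * V = 1)
    (A : Matrix (Fin m) (Fin n) ℝ) : frobSq (U * A * Vᵀ) = frobSq A := by
  have e : (U * A * Vᵀ)ᵀ * (U * A * Vᵀ) = V * (Aᵀ * (Uᵀ * U) * A) * Vᵀ := by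
    simp only [transpose_mul, transpose_transpose, Matrix.mul_assoc]
  rw [frobSq_eq_trace, frobSq_eq_trace, e, hU, Matrix.trace_mul_comm, ← Matrix.mul_assoc, hV,
    Matrix.one_mul, Matrix.mul_one]

/-- Chebyshev's sum inequality: `a` decreases while the indicator of `r ≤ i` increases, so the tail
has at most its proportional share of the sum. -/
theorem sum_ite_le_of_antitone {m r : ℕ} (hm : 0 < m) (hr : r ≤ m) {a : Fin m → ℝ}
    (ha : Antitone a) :
    ∑ i : Fin m, (if (i : ℕ) < r then 0 else a i) ≤ (1 - (r : ℝ) / m) * ∑ i, a i := by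
  have hav : Antivary a (fun i : Fin m => if (i : ℕ) < r then (0 : ℝ) else 1) := by
    refine ha.antivary fun i j hij => ?_
    have : (i : ℕ) ≤ j := hij
    split_ifs <;> first | omega | norm_num
  have h := hav.card_mul_sum_le_sum_mul_sum
  have hc : ∑ i : Fin m, (if (i : ℕ) < r then (0 : ℝ) else 1) = m - r := by
    have e : ∀ i : Fin m, (if (i : ℕ) < r then (0 : ℝ) else 1) =
        1 - (if (i : ℕ) < r then 1 else 0) := fun i => by split_ifs <;> norm_num
    simp_rw [e]
    rw [Finset.sum_sub_distrib, Finset.sum_boole]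
    have : (Finset.univ.filter fun i : Fin m => (i : ℕ) < r).card = r := by
      rw [Fin.card_filter_val_lt]; omega
    simp [this]
  rw [hc, Fintype.card_fin] at h
  have hm' : (0 : ℝ) < m := by exact_mod_cast hm
  simp only [mul_ite, mul_zero, mul_one] at h
  have e : (1 - (r : ℝ) / m) * ∑ i, a i = ((∑ i, a i) * (m - r)) / m := by field_simp
  rw [e, le_div_iff₀ hm']
  linarith

/-- Each row of `Σ` has a single possibly nonzero entry, so these sums are the squared singular
values. -/
theorem IsSVD.antitone_rows {m n : ℕ} (hmn : m ≤ n) {G : Matrix (Fin m) (Fin n) ℝ}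
    {s : SVDFactors m n} (h : IsSVD G s) : Antitone fun i => ∑ j, s.S i j ^ 2 := by
  have e : ∀ i, ∑ j, s.S i j ^ 2 = s.S i (Fin.castLE hmn i) ^ 2 := fun i =>
    Finset.sum_eq_single _ (fun j _ hj => by
      rw [h.diag i j fun hij => hj (Fin.ext (by simpa using hij.symm))]; norm_num) (by simp)
  intro i i' hi
  simp only [e]
  exact pow_le_pow_left₀ (h.nonneg _ _) (h.antitone i i' _ _ (by simp) (by simp) hi) 2

open Matrix in
theorem firstCols_mul_transpose {m r : ℕ} (h : r ≤ m) (U : Matrix (Fin m) (Fin m) ℝ) :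
    firstCols h U * (firstCols h U)ᵀ =
      U * diagonal (fun i : Fin m => if (i : ℕ) < r then (1 : ℝ) else 0) * Uᵀ := by
  ext i j
  rw [Matrix.mul_apply, Matrix.mul_apply]
  simp only [mul_diagonal, transpose_apply, firstCols, submatrix_apply, id]
  have e : ∑ k : Fin r, U i (Fin.castLE h k) * U j (Fin.castLE h k) =
      ∑ k ∈ Finset.univ.map (Fin.castLEEmb h), U i k * U j k := by simp
  rw [e]
  refine Finset.sum_subset_zero_on_sdiff (Finset.subset_univ _) (fun k hk => ?_) fun k hk => ?_
  · have : ¬ (k : ℕ) < r := fun hkr => (Finset.mem_sdiff.1 hk).2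
      (Finset.mem_map.2 ⟨⟨k, hkr⟩, Finset.mem_univ _, Fin.ext rfl⟩)
    simp [this]
  · obtain ⟨k, -, rfl⟩ := Finset.mem_map.1 hk
    simp

open Matrix in
theorem transpose_firstCols_mul {m r : ℕ} (h : r ≤ m) {U : Matrix (Fin m) (Fin m) ℝ}
    (hU : Uᵀ * U = 1) : (firstCols h U)ᵀ * firstCols h U = 1 := by
  ext i j
  have := congr_fun (congr_fun hU (Fin.castLE h i)) (Fin.castLE h j)
  simp only [Matrix.mul_apply, transpose_apply, firstCols, submatrix_apply, id] at this ⊢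
  rw [this, Matrix.one_apply, Matrix.one_apply]
  simp [Fin.ext_iff]

open Matrix in
-- In the singular bases the projection deletes the residual's first `r` rows of `Σ`, which carry
-- the largest singular values. The remaining rows hold at most the average share of the energy, by
-- `sum_ite_le_of_antitone`.
theorem IsSVD.capture {m n r : ℕ} (hmn : m ≤ n) (hm : 0 < m) (hr : r ≤ m)
    {G : Matrix (Fin m) (Fin n) ℝ} {s : SVDFactors m n} (h : IsSVD G s) :
    frobSq (G - firstCols hr s.U * (firstCols hr s.U)ᵀ * G) ≤ (1 - (r : ℝ) / m) * frobSq G := by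
  have hU : s.Uᵀ * s.U = 1 := (Matrix.mem_orthogonalGroup_iff' (Fin m) ℝ).1 h.orthogonal_U
  have hV : s.Vᵀ * s.V = 1 := (Matrix.mem_orthogonalGroup_iff' (Fin n) ℝ).1 h.orthogonal_V
  have e : G - firstCols hr s.U * (firstCols hr s.U)ᵀ * G =
      s.U * (s.S - diagonal (fun i : Fin m => if (i : ℕ) < r then (1 : ℝ) else 0) * s.S) * s.Vᵀ := by
    rw [firstCols_mul_transpose]
    nth_rewrite 1 2 [h.eq_mul]
    rw [Matrix.mul_sub, Matrix.sub_mul]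
    congr 1
    calc _ = s.U * diagonal (fun i : Fin m => if (i : ℕ) < r then (1 : ℝ) else 0) *
          (s.Uᵀ * s.U) * s.S * s.Vᵀ := by simp only [Matrix.mul_assoc]
      _ = _ := by rw [hU]; simp only [Matrix.mul_assoc, Matrix.mul_one]
  have e1 : frobSq G = ∑ i, ∑ j, s.S i j ^ 2 := by
    rw [h.eq_mul, frobSq_mul_mul_transpose hU hV]; rfl
  rw [e, frobSq_mul_mul_transpose hU hV, e1]
  refine le_of_eq_of_le ?_ (sum_ite_le_of_antitone hm hr (h.antitone_rows hmn))
  refine Finset.sum_congr rfl fun i _ => ?_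
  simp only [Matrix.sub_apply, diagonal_mul]
  split_ifs <;> simp

open Matrix in
-- Reduces projection from the right, used for `m > n`, to projection from the left.
theorem IsSVD.transpose {m n : ℕ} {G : Matrix (Fin m) (Fin n) ℝ} {s : SVDFactors m n}
    (h : IsSVD G s) : IsSVD Gᵀ ⟨s.V, s.Sᵀ, s.U⟩ where
  orthogonal_U := h.orthogonal_V
  orthogonal_V := h.orthogonal_U
  eq_mul := by
    rw [h.eq_mul, transpose_mul, transpose_mul, transpose_transpose, Matrix.mul_assoc]
  diag i j hij := h.diag j i (Ne.symm hij)
  nonneg i j := h.nonneg j i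
  antitone i i' j j' h1 h2 hi := h.antitone j j' i i' h1.symm h2.symm (by
    rw [Fin.le_def] at hi ⊢; omega)

/-! ### The projection of the parameter space held in memory -/

/-- The projection of a layer gradient onto the current subspace. -/
noncomputable def LayerMem.proj {m n r : ℕ} (c : LayerMem m n r) (G : Matrix (Fin m) (Fin n) ℝ) :
    Matrix (Fin m) (Fin n) ℝ :=
  if m ≤ n then c.P * c.P.transpose * G else G * (c.Q * c.Q.transpose)

/-- The projection matrices are partial isometries (either zero or with orthonormal columns). -/
structure LayerMem.IsPartialIsometry {m n r : ℕ} (c : LayerMem m n r) : Prop where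
  left : c.P * c.P.transpose * c.P = c.P
  right : c.Q * c.Q.transpose * c.Q = c.Q

section Update

variable {m n r : ℕ} (h : r ≤ min m n) (H : Hyper) (t : ℕ) {G : Matrix (Fin m) (Fin n) ℝ}
  {s : SVDFactors m n} {c : LayerMem m n r}

theorem updateMem_isPartialIsometry (hs : IsSVD G s) (hc : c.IsPartialIsometry) :
    (updateMem h H t G s c).IsPartialIsometry := by
  have hU := (Matrix.mem_orthogonalGroup_iff' (Fin m) ℝ).1 hs.orthogonal_U
  have hV := (Matrix.mem_orthogonalGroup_iff' (Fin n) ℝ).1 hs.orthogonal_V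
  unfold updateMem
  split_ifs
  · exact ⟨by simp only [Matrix.mul_assoc, transpose_firstCols_mul _ hU, Matrix.mul_one], hc.right⟩
  · exact ⟨hc.left, by simp only [Matrix.mul_assoc, transpose_firstCols_mul _ hV, Matrix.mul_one]⟩
  · exact ⟨hc.left, hc.right⟩
  · exact ⟨hc.left, hc.right⟩

/-- At a switch, `P⁺ (P⁺)ᵀ P M` is the new projection of the old full-size momentum. Between
switches `P Pᵀ P = P` is what is needed, and unlike `Pᵀ P = 1` it also holds for the zero matrices
of the initial state. -/
theorem updateMem_direction (hc : c.IsPartialIsometry) :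
    (updateMem h H t G s c).direction =
      (updateMem h H t G s c).proj ((1 - H.β) • c.direction + H.β • G) := by
  have hl : ∀ M : Matrix (Fin r) (Fin n) ℝ, c.P * (c.P.transpose * (c.P * M)) = c.P * M :=
      fun M => by
    rw [← Matrix.mul_assoc, ← Matrix.mul_assoc, hc.left]
  have hq : c.Q.transpose * (c.Q * c.Q.transpose) = c.Q.transpose := by
    have := congr_arg Matrix.transpose hc.right
    simpa [Matrix.transpose_mul, Matrix.mul_assoc] using this
  unfold updateMem LayerMem.direction LayerMem.proj
  split_ifs
  · simp only [Matrix.mul_add, Matrix.mul_smul, Matrix.mul_assoc]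
  · simp only [Matrix.mul_add, Matrix.mul_smul, Matrix.mul_assoc, hl]
  · simp only [Matrix.add_mul, Matrix.smul_mul, Matrix.mul_assoc]
  · simp only [Matrix.add_mul, Matrix.smul_mul, Matrix.mul_assoc, hq]

theorem updateMem_proj_of_not_switch (ht : t % H.τ ≠ 0) :
    (updateMem h H t G s c).proj = c.proj := by
  unfold updateMem LayerMem.proj
  rw [if_neg ht]
  split_ifs <;> rfl

theorem updateMem_capture (h0 : 0 < r) (hs : IsSVD G s) (ht : t % H.τ = 0) :
    frobSq (G - (updateMem h H t G s c).proj G) ≤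
      (1 - (r : ℝ) / (min m n : ℕ)) * frobSq G := by
  unfold updateMem LayerMem.proj
  rw [if_pos ht]
  have h1 := h.trans (min_le_left m n)
  have h2 := h.trans (min_le_right m n)
  by_cases hmn : m ≤ n
  · simp only [hmn, if_true, min_eq_left]
    exact hs.capture hmn (by omega) h1
  · simp only [hmn, if_false]
    have := hs.transpose.capture (by omega) (by omega) h2
    rw [min_eq_right (by omega), ← frobSq_transpose G, ← frobSq_transpose (G - _)]
    simpa [Matrix.transpose_mul, Matrix.mul_assoc] using this

end Update

section Global

variable {A : Arch}

theorem layer_ofLayers (X : ∀ l : Fin A.N, Matrix (Fin (A.m l)) (Fin (A.n l)) ℝ) (l : Fin A.N) :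
    layer (ofLayers X) l = X l := rfl

theorem params_ext {x y : A.Params} (h : ∀ l, layer x l = layer y l) : x = y := by
  ext ⟨l, i, j⟩
  exact congr_fun (congr_fun (h l) i) j

theorem layer_add (x y : A.Params) (l : Fin A.N) : layer (x + y) l = layer x l + layer y l := rfl

theorem layer_sub (x y : A.Params) (l : Fin A.N) : layer (x - y) l = layer x l - layer y l := rfl

theorem layer_smul (a : ℝ) (x : A.Params) (l : Fin A.N) : layer (a • x) l = a • layer x l := rfl

theorem inner_eq_sum_trace (x y : A.Params) :
    inner ℝ x y = ∑ l, ((layer x l).transpose * layer y l).trace := by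
  rw [PiLp.inner_apply, Fintype.sum_sigma]
  refine Finset.sum_congr rfl fun l _ => ?_
  rw [Fintype.sum_prod_type, Finset.sum_comm]
  simp [Matrix.trace, Matrix.mul_apply, layer, mul_comm]

theorem norm_sq_eq_sum_frobSq (x : A.Params) : ‖x‖ ^ 2 = ∑ l, frobSq (layer x l) := by
  rw [← real_inner_self_eq_norm_sq, inner_eq_sum_trace]
  simp_rw [frobSq_eq_trace]

theorem LayerMem.proj_add {m n r : ℕ} (c : LayerMem m n r) (G G' : Matrix (Fin m) (Fin n) ℝ) :
    c.proj (G + G') = c.proj G + c.proj G' := by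
  unfold LayerMem.proj
  split_ifs <;> simp [Matrix.mul_add, Matrix.add_mul]

theorem LayerMem.proj_smul {m n r : ℕ} (c : LayerMem m n r) (a : ℝ)
    (G : Matrix (Fin m) (Fin n) ℝ) : c.proj (a • G) = a • c.proj G := by
  unfold LayerMem.proj
  split_ifs <;> simp

/-- The projection of the parameter space onto the subspaces held in memory. -/
noncomputable def memProj (mem : ∀ l : Fin A.N, LayerMem (A.m l) (A.n l) (A.r l)) :
    A.Params →ₗ[ℝ] A.Params where
  toFun x := ofLayers fun l => (mem l).proj (layer x l)
  map_add' x y := params_ext fun l => by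
    simp only [layer_ofLayers, layer_add, LayerMem.proj_add]
  map_smul' a x := params_ext fun l => by
    simp only [layer_ofLayers, layer_smul, LayerMem.proj_smul, RingHom.id_apply]

theorem layer_memProj (mem : ∀ l : Fin A.N, LayerMem (A.m l) (A.n l) (A.r l)) (x : A.Params)
    (l : Fin A.N) : layer (memProj mem x) l = (mem l).proj (layer x l) := rfl

theorem memProj_isSymmetricProjection {mem : ∀ l : Fin A.N, LayerMem (A.m l) (A.n l) (A.r l)}
    (h : ∀ l, (mem l).IsPartialIsometry) : (memProj mem).IsSymmetricProjection where
  isIdempotentElem := by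
    refine LinearMap.ext fun x => params_ext fun l => ?_
    simp only [Module.End.mul_apply, layer_memProj]
    unfold LayerMem.proj
    split_ifs
    · rw [← Matrix.mul_assoc, ← Matrix.mul_assoc, (h l).left]
    · rw [Matrix.mul_assoc, ← Matrix.mul_assoc _ (mem l).Q, (h l).right]
  isSymmetric x y := by
    rw [inner_eq_sum_trace, inner_eq_sum_trace]
    refine Finset.sum_congr rfl fun l _ => ?_
    simp only [layer_memProj]
    unfold LayerMem.proj
    split_ifs
    · simp [Matrix.transpose_mul, Matrix.mul_assoc]
    -- Right multiplication by `Q Qᵀ` is moved across the trace pairing by cyclicity.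
    · simp only [Matrix.transpose_mul, Matrix.transpose_transpose, Matrix.mul_assoc]
      rw [Matrix.trace_mul_comm]
      simp only [Matrix.mul_assoc]
      rw [Matrix.trace_mul_comm]
      simp only [Matrix.mul_assoc]

/-- The momentum as a vector of the parameter space. -/
noncomputable def memDirection (mem : ∀ l : Fin A.N, LayerMem (A.m l) (A.n l) (A.r l)) : A.Params :=
  ofLayers fun l => (mem l).direction

theorem layer_memDirection (mem : ∀ l : Fin A.N, LayerMem (A.m l) (A.n l) (A.r l)) (l : Fin A.N) :
    layer (memDirection mem) l = (mem l).direction := rfl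

theorem delta_pos (A : Arch) (l : Fin A.N) : 0 < A.delta l := by
  have h1 := A.r_pos l
  have h2 := A.r_le l
  unfold Arch.delta
  have : 0 < min (A.m l) (A.n l) := by omega
  positivity

theorem delta_le_one (A : Arch) (l : Fin A.N) : A.delta l ≤ 1 := by
  unfold Arch.delta
  exact div_le_one_of_le₀ (by exact_mod_cast A.r_le l) (by positivity)

theorem minDelta_le (A : Arch) (l : Fin A.N) : A.minDelta ≤ A.delta l :=
  ciInf_le (Set.finite_range _).bddBelow l

theorem minDelta_pos (A : Arch) : 0 < A.minDelta := by
  have : Nonempty (Fin A.N) := ⟨⟨0, A.N_pos⟩⟩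
  obtain ⟨l, hl⟩ := exists_eq_ciInf_of_finite (f := A.delta)
  unfold Arch.minDelta
  rw [← hl]
  exact delta_pos A l

theorem minDelta_le_one (A : Arch) : A.minDelta ≤ 1 :=
  (minDelta_le A ⟨0, A.N_pos⟩).trans (delta_le_one A _)

end Global

/-! ### GaLore iterations as vectors of the parameter space -/

section Step

variable {A : Arch} {Ξ : Type*} {H : Hyper} {F : A.Params → Ξ → ℝ} {svd : SVDRule A}
  {x0 : A.Params} {z : ℕ → ℕ → Ξ}

/-- The gradient estimate as a vector of the parameter space. -/
noncomputable def gradEstVec (H : Hyper) (F : A.Params → Ξ → ℝ) (t : ℕ)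
    (x : A.Params) (z : ℕ → Ξ) : A.Params :=
  ofLayers (gradEst H F t x z)

theorem layer_gradEstVec (t : ℕ) (x : A.Params) (z : ℕ → Ξ) (l : Fin A.N) :
    layer (gradEstVec H F t x z) l = gradEst H F t x z l := rfl

theorem mem_run_succ (t : ℕ) (l : Fin A.N) :
    (run H F svd x0 z (t + 1)).mem l = updateMem (A.r_le l) H t
      (gradEst H F t (run H F svd x0 z t).x (z t) l)
      (svd t l (gradEst H F t (run H F svd x0 z t).x (z t) l)) ((run H F svd x0 z t).mem l) := rfl

theorem run_isPartialIsometry (hs : ∀ t l G, IsSVD G (svd t l G)) (t : ℕ) (l : Fin A.N) :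
    ((run H F svd x0 z t).mem l).IsPartialIsometry := by
  induction t with
  | zero => exact ⟨by simp [run, initState], by simp [run, initState]⟩
  | succ t ih =>
    rw [mem_run_succ]
    exact updateMem_isPartialIsometry _ _ _ (hs _ _ _) ih

theorem run_succ_x (t : ℕ) :
    (run H F svd x0 z (t + 1)).x =
      (run H F svd x0 z t).x - H.η • memDirection (run H F svd x0 z (t + 1)).mem := rfl

theorem memDirection_run_succ (hs : ∀ t l G, IsSVD G (svd t l G)) (t : ℕ) :
    memDirection (run H F svd x0 z (t + 1)).mem = memProj (run H F svd x0 z (t + 1)).mem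
      ((1 - H.β) • memDirection (run H F svd x0 z t).mem +
        H.β • gradEstVec H F t (run H F svd x0 z t).x (z t)) :=
  params_ext fun l => by
    rw [layer_memProj, layer_memDirection, mem_run_succ, layer_add, layer_smul, layer_smul,
      layer_memDirection, layer_gradEstVec]
    exact updateMem_direction _ _ _ (run_isPartialIsometry hs t l)

theorem memProj_run_succ {t : ℕ} (ht : t % H.τ ≠ 0) :
    memProj (run H F svd x0 z (t + 1)).mem = memProj (run H F svd x0 z t).mem :=
  LinearMap.ext fun x => params_ext fun l => by
    rw [layer_memProj, layer_memProj, mem_run_succ, updateMem_proj_of_not_switch _ H t ht]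

theorem memProj_run_zero : memProj (run H F svd x0 z 0).mem = 0 :=
  LinearMap.ext fun x => params_ext fun l => by
    simp [layer_memProj, run, initState, LayerMem.proj]
    rfl

theorem memDirection_run_zero : memDirection (run H F svd x0 z 0).mem = 0 :=
  params_ext fun l => by
    simp [layer_memDirection, run, initState, LayerMem.direction]
    rfl

theorem run_capture (hs : ∀ t l G, IsSVD G (svd t l G)) {t : ℕ} (ht : t % H.τ = 0) :
    ‖gradEstVec H F t (run H F svd x0 z t).x (z t) - memProj (run H F svd x0 z (t + 1)).mem
      (gradEstVec H F t (run H F svd x0 z t).x (z t))‖ ^ 2 ≤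
      (1 - A.minDelta) * ‖gradEstVec H F t (run H F svd x0 z t).x (z t)‖ ^ 2 := by
  rw [norm_sq_eq_sum_frobSq, norm_sq_eq_sum_frobSq, Finset.mul_sum]
  refine Finset.sum_le_sum fun l _ => ?_
  have h1 : frobSq (layer (gradEstVec H F t (run H F svd x0 z t).x (z t) -
      memProj (run H F svd x0 z (t + 1)).mem
        (gradEstVec H F t (run H F svd x0 z t).x (z t))) l) ≤ (1 - A.delta l) *
      frobSq (layer (gradEstVec H F t (run H F svd x0 z t).x (z t)) l) :=
by
    rw [layer_sub, layer_memProj, layer_gradEstVec, mem_run_succ]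
    exact updateMem_capture _ H t (A.r_pos l) (hs _ _ _) ht
  refine h1.trans (mul_le_mul_of_nonneg_right ?_ ?_)
  · linarith [minDelta_le A l]
  · exact Finset.sum_nonneg fun _ _ => Finset.sum_nonneg fun _ _ => sq_nonneg _

end Step

/-! ### The sample gradients -/

section Noise

variable {A : Arch} {Ξ : Type*} [MeasurableSpace Ξ] {D : Measure Ξ} {F : A.Params → Ξ → ℝ}
  {σ : Fin A.N → ℝ}

theorem measurable_params {Ω : Type*} [MeasurableSpace Ω] {x : Ω → A.Params}
    (h : ∀ i, Measurable fun ω => x ω i) : Measurable x := by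
  have : x = fun ω => WithLp.toLp 2 fun i => x ω i := rfl
  rw [this]
  exact (WithLp.measurable_toLp 2 _).comp (measurable_pi_lambda _ h)

theorem measurable_coord {Ω : Type*} [MeasurableSpace Ω] {x : Ω → A.Params}
    (h : Measurable x) (i) : Measurable fun ω => x ω i :=
  (measurable_pi_apply i).comp ((WithLp.measurable_ofLp 2 _).comp h)

theorem gradient_apply {f : A.Params → ℝ} {x : A.Params} (i) :
    gradient f x i = fderiv ℝ f x (EuclideanSpace.single i 1) := by
  have h : inner ℝ (gradient f x) (EuclideanSpace.single i (1 : ℝ)) =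
      fderiv ℝ f x (EuclideanSpace.single i 1) := by
    unfold gradient
    rw [InnerProductSpace.toDual_symm_apply]
  rw [← h, EuclideanSpace.inner_single_right]
  simp

/-- `F` is continuous in the parameters and measurable in the sample, hence jointly measurable;
partial derivatives are limits of its difference quotients. -/
theorem measurable_gradient_uncurry (hm : ∀ x, Measurable (F x))
    (hd : ∀ z, Differentiable ℝ fun x => F x z) :
    Measurable fun q : A.Params × Ξ => gradient (fun y => F y q.2) q.1 := by
  have hF : Measurable (Function.uncurry F) :=
    measurable_uncurry_of_continuous_of_measurable (fun z => (hd z).continuous) hm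
  refine measurable_params fun i => ?_
  simp_rw [gradient_apply]
  refine measurable_of_tendsto_metrizable (f := fun (k : ℕ) (q : A.Params × Ξ) =>
    (k : ℝ) • (F (q.1 + (k : ℝ)⁻¹ • EuclideanSpace.single i 1) q.2 - F q.1 q.2)) (fun k => ?_) ?_
  · have h1 : Measurable fun q : A.Params × Ξ =>
        F (q.1 + (k : ℝ)⁻¹ • EuclideanSpace.single i 1) q.2 :=
      hF.comp ((measurable_fst.add_const _).prodMk measurable_snd)
    exact (h1.sub hF).const_smul (k : ℝ)
  · rw [tendsto_pi_nhds]
    intro q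
    refine (hd q.2 q.1).hasFDerivAt.lim (EuclideanSpace.single i 1) ?_
    simpa using tendsto_natCast_atTop_atTop

/-- The error of the stochastic gradient of the sample `z` at `x`. -/
@[irreducible]
noncomputable def sampleNoise (D : Measure Ξ) (F : A.Params → Ξ → ℝ) (x : A.Params) (z : Ξ) :
    A.Params :=
  gradient (fun y => F y z) x - gradient (objective D F) x

theorem measurable_sampleNoise (hF : StochasticGradient D F σ)
    (hc : Continuous (gradient (objective D F))) :
    Measurable fun q : A.Params × Ξ => sampleNoise D F q.1 q.2 := by
  unfold sampleNoise
  exact (measurable_gradient_uncurry hF.measurable hF.differentiable).sub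
    (hc.measurable.comp measurable_fst)

theorem measurable_sampleNoise_comp (hF : StochasticGradient D F σ)
    (hc : Continuous (gradient (objective D F))) {Ω : Type*} {_ : MeasurableSpace Ω}
    {X : Ω → A.Params} {ζ : Ω → Ξ} (hX : Measurable X) (hζ : Measurable ζ) :
    Measurable fun ω => sampleNoise D F (X ω) (ζ ω) :=
  (measurable_sampleNoise hF hc).comp (hX.prodMk hζ)

theorem norm_sampleNoise_sq (x : A.Params) (z : Ξ) :
    ‖sampleNoise D F x z‖ ^ 2 =
      ∑ l, frobSq (layerGrad (fun y => F y z) x l - layerGrad (objective D F) x l) := by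
  unfold sampleNoise
  exact norm_sq_eq_sum_frobSq _

theorem integrable_norm_sampleNoise_sq (hF : StochasticGradient D F σ) (x : A.Params) :
    Integrable (fun z => ‖sampleNoise D F x z‖ ^ 2) D := by
  simp_rw [norm_sampleNoise_sq]
  exact integrable_finsetSum _ fun l _ => hF.variance_integrable x l

theorem integral_norm_sampleNoise_sq_le (hF : StochasticGradient D F σ) (x : A.Params) :
    ∫ z, ‖sampleNoise D F x z‖ ^ 2 ∂D ≤ totalSigma σ ^ 2 := by
  simp_rw [norm_sampleNoise_sq]
  rw [integral_finsetSum _ fun l _ => hF.variance_integrable x l, totalSigma,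
    Real.sq_sqrt (Finset.sum_nonneg fun l _ => sq_nonneg _)]
  exact Finset.sum_le_sum fun l _ => hF.variance_le x l

theorem integral_inner_sampleNoise [IsProbabilityMeasure D] (hF : StochasticGradient D F σ)
    (hc : Continuous (gradient (objective D F))) (x y : A.Params) :
    ∫ z, inner ℝ y (sampleNoise D F x z) ∂D = 0 := by
  have hm : Measurable fun z => sampleNoise D F x z :=
    measurable_sampleNoise_comp hF hc measurable_const measurable_id
  -- Finite variance yields the integrability of the entries, without which the Bochner integrals in
  -- `unbiased` could not be split.
  have hL : MemLp (fun z => sampleNoise D F x z) 2 D :=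
    (memLp_two_iff_integrable_sq_norm hm.aestronglyMeasurable).2
      (integrable_norm_sampleNoise_sq hF x)
  have hi : Integrable (fun z => sampleNoise D F x z) D := hL.integrable one_le_two
  have hi' : ∀ i, Integrable (fun z => sampleNoise D F x z i) D := fun i =>
    hi.norm.mono' (measurable_coord hm i).aestronglyMeasurable
      (Filter.Eventually.of_forall fun z => PiLp.norm_apply_le _ i)
  have h0 : ∀ i, ∫ z, sampleNoise D F x z i ∂D = 0 := by
    rintro ⟨l, i, j⟩
    have e : (fun z => gradient (fun y => F y z) x ⟨l, i, j⟩) =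
        fun z => sampleNoise D F x z ⟨l, i, j⟩ + gradient (objective D F) x ⟨l, i, j⟩ := by
      funext z; simp [sampleNoise]
    have hu : ∫ z, gradient (fun y => F y z) x ⟨l, i, j⟩ ∂D =
        gradient (objective D F) x ⟨l, i, j⟩ := hF.unbiased x l i j
    rw [e, integral_add (hi' _) (integrable_const _)] at hu
    simpa using hu
  simp_rw [PiLp.inner_apply]
  rw [integral_finsetSum _ fun i _ => ?_]
  · refine Finset.sum_eq_zero fun i _ => ?_
    simp [integral_mul_const, h0 i]
  · simpa using (hi' i).mul_const (y i)

variable {Ω : Type*} [MeasurableSpace Ω] {μ : Measure Ω} [IsProbabilityMeasure μ]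
  [IsProbabilityMeasure D]

/-- By independence the joint law is a product, and Fubini reduces to a fixed point `x`, where the
variance bound is uniform. -/
theorem memLp_sampleNoise_comp (hF : StochasticGradient D F σ)
    (hc : Continuous (gradient (objective D F))) {X : Ω → A.Params} {ζ : Ω → Ξ}
    (hX : Measurable X) (hζ : Measurable ζ) (hl : μ.map ζ = D) (hi : IndepFun X ζ μ) :
    MemLp (fun ω => sampleNoise D F (X ω) (ζ ω)) 2 μ ∧
      ∫ ω, ‖sampleNoise D F (X ω) (ζ ω)‖ ^ 2 ∂μ ≤ totalSigma σ ^ 2 := by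
  have hm := measurable_sampleNoise hF hc
  have hp : μ.map (fun ω => (X ω, ζ ω)) = (μ.map X).prod D := by
    rw [← hl]
    exact (indepFun_iff_map_prod_eq_prod_map_map hX.aemeasurable hζ.aemeasurable).1 hi
  have : IsProbabilityMeasure (μ.map X) := Measure.isProbabilityMeasure_map hX.aemeasurable
  have hsm : StronglyMeasurable fun q : A.Params × Ξ => ‖sampleNoise D F q.1 q.2‖ ^ 2 :=
    (hm.norm.pow_const 2).stronglyMeasurable
  have hb : Integrable (fun x => ∫ z, ‖sampleNoise D F x z‖ ^ 2 ∂D) (μ.map X) := by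
    refine (integrable_const (totalSigma σ ^ 2)).mono'
      hsm.integral_prod_right.aestronglyMeasurable (Filter.Eventually.of_forall fun x => ?_)
    rw [Real.norm_of_nonneg (integral_nonneg fun _ => sq_nonneg _)]
    exact integral_norm_sampleNoise_sq_le hF x
  have hint : Integrable (fun q : A.Params × Ξ => ‖sampleNoise D F q.1 q.2‖ ^ 2)
      ((μ.map X).prod D) := by
    refine (integrable_prod_iff hsm.aestronglyMeasurable).2
      ⟨Filter.Eventually.of_forall fun x => integrable_norm_sampleNoise_sq hF x, ?_⟩
    simpa using hb
  have hXζ : Measurable fun ω => (X ω, ζ ω) := hX.prodMk hζ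
  constructor
  · rw [memLp_two_iff_integrable_sq_norm
      (measurable_sampleNoise_comp hF hc hX hζ).aestronglyMeasurable]
    rw [← hp] at hint
    exact (integrable_map_measure hsm.aestronglyMeasurable hXζ.aemeasurable).1 hint
  · have e : ∫ ω, ‖sampleNoise D F (X ω) (ζ ω)‖ ^ 2 ∂μ =
        ∫ x, ∫ z, ‖sampleNoise D F x z‖ ^ 2 ∂D ∂(μ.map X) := by
      rw [← integral_prod _ hint, ← hp,
        integral_map hXζ.aemeasurable hsm.aestronglyMeasurable]
    rw [e]
    refine (integral_mono hb (integrable_const (totalSigma σ ^ 2))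
      (fun x => integral_norm_sampleNoise_sq_le hF x)).trans_eq (by simp)

/-- Plays the role of conditioning on the past: for frozen `(Y, X)` the inner integral vanishes by
unbiasedness. -/
theorem integral_inner_sampleNoise_comp (hF : StochasticGradient D F σ)
    (hc : Continuous (gradient (objective D F))) {X Y : Ω → A.Params} {ζ : Ω → Ξ}
    (hX : Measurable X) (hY : Measurable Y) (hζ : Measurable ζ) (hl : μ.map ζ = D)
    (hi : IndepFun (fun ω => (Y ω, X ω)) ζ μ) (hY2 : MemLp Y 2 μ) :
    ∫ ω, inner ℝ (Y ω) (sampleNoise D F (X ω) (ζ ω)) ∂μ = 0 := by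
  have hYX : Measurable fun ω => (Y ω, X ω) := hY.prodMk hX
  have hp : μ.map (fun ω => ((Y ω, X ω), ζ ω)) = (μ.map fun ω => (Y ω, X ω)).prod D := by
    rw [← hl]
    exact (indepFun_iff_map_prod_eq_prod_map_map hYX.aemeasurable hζ.aemeasurable).1 hi
  have : IsProbabilityMeasure (μ.map fun ω => (Y ω, X ω)) :=
    Measure.isProbabilityMeasure_map hYX.aemeasurable
  have hn := (memLp_sampleNoise_comp hF hc hX hζ hl (hi.comp measurable_snd measurable_id)).1
  have hYXζ : Measurable fun ω => ((Y ω, X ω), ζ ω) := hYX.prodMk hζ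
  have hsm : Measurable fun q : (A.Params × A.Params) × Ξ =>
      inner ℝ q.1.1 (sampleNoise D F q.1.2 q.2) :=
    Measurable.inner (measurable_fst.comp measurable_fst)
      (measurable_sampleNoise_comp hF hc (measurable_snd.comp measurable_fst) measurable_snd)
  have hint : Integrable (fun q : (A.Params × A.Params) × Ξ =>
      inner ℝ q.1.1 (sampleNoise D F q.1.2 q.2)) ((μ.map fun ω => (Y ω, X ω)).prod D) := by
    rw [← hp, integrable_map_measure hsm.aestronglyMeasurable hYXζ.aemeasurable]
    exact integrable_inner_of_memLp hY2 hn
  have e : ∫ ω, inner ℝ (Y ω) (sampleNoise D F (X ω) (ζ ω)) ∂μ =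
      ∫ q, ∫ z, inner ℝ q.1 (sampleNoise D F q.2 z) ∂D ∂(μ.map fun ω => (Y ω, X ω)) := by
    rw [← integral_prod _ hint, ← hp, integral_map hYXζ.aemeasurable hsm.aestronglyMeasurable]
  rw [e]
  simp [integral_inner_sampleNoise hF hc]

end Noise

/-! ### Independence of the past -/

section Past

variable {Ξ Ω : Type*} [MeasurableSpace Ξ]

/-- The σ-algebra generated by the samples with index in `I`. -/
@[reducible]
def sampleAlgebra (ξ : ℕ → ℕ → Ω → Ξ) (I : Set (ℕ × ℕ)) : MeasurableSpace Ω :=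
  ⨆ q ∈ I, MeasurableSpace.comap (ξ q.1 q.2) inferInstance

/-- The indices of the samples drawn before the sample `j` of iteration `t`. -/
def before (t j : ℕ) : Set (ℕ × ℕ) := {q | q.1 < t ∨ q.1 = t ∧ q.2 < j}

theorem measurable_sampleAlgebra {ξ : ℕ → ℕ → Ω → Ξ} {I : Set (ℕ × ℕ)} {t b : ℕ}
    (h : (t, b) ∈ I) : Measurable[sampleAlgebra ξ I] (ξ t b) :=
  Measurable.mono (measurable_iff_comap_le.2 le_rfl)
    (le_iSup₂_of_le (f := fun (q : ℕ × ℕ) (_ : q ∈ I) =>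
      MeasurableSpace.comap (ξ q.1 q.2) inferInstance) (t, b) h le_rfl) le_rfl

theorem sampleAlgebra_mono {ξ : ℕ → ℕ → Ω → Ξ} {I J : Set (ℕ × ℕ)} (h : I ⊆ J) :
    sampleAlgebra ξ I ≤ sampleAlgebra ξ J :=
  biSup_mono fun _ hq => h hq

variable [mΩ : MeasurableSpace Ω] {D : Measure Ξ} {μ : Measure Ω}

theorem IIDSamples.sampleAlgebra_le {ξ : ℕ → ℕ → Ω → Ξ} (h : IIDSamples D μ ξ)
    (I : Set (ℕ × ℕ)) : sampleAlgebra ξ I ≤ mΩ :=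
  iSup₂_le fun q _ => (h.measurable q.1 q.2).comap_le

/-- Disjoint groups of independent samples generate independent σ-algebras. -/
theorem IIDSamples.indepFun {ξ : ℕ → ℕ → Ω → Ξ} (h : IIDSamples D μ ξ) {I : Set (ℕ × ℕ)}
    {t b : ℕ} (hI : (t, b) ∉ I) {β : Type*} [mβ : MeasurableSpace β] {S : Ω → β}
    (hS : Measurable[sampleAlgebra ξ I] S) : IndepFun S (ξ t b) μ := by
  rw [IndepFun_iff_Indep]
  have h1 := indep_iSup_of_disjoint
    (m := fun q : ℕ × ℕ => MeasurableSpace.comap (ξ q.1 q.2) inferInstance)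
    (fun q => (h.measurable q.1 q.2).comap_le) ((iIndepFun_iff_iIndep _ _ _).1 h.indep)
    (S := I) (T := {(t, b)}) (by simpa using hI)
  refine indep_of_indep_of_le h1 (measurable_iff_comap_le.1 hS) ?_
  exact le_iSup₂_of_le (f := fun (q : ℕ × ℕ) (_ : q ∈ ({(t, b)} : Set (ℕ × ℕ))) =>
      MeasurableSpace.comap (ξ q.1 q.2) inferInstance) (t, b) rfl le_rfl

end Past

/-! ### Noise of a batch given the past -/

section Batch

variable {A : Arch} {Ξ : Type*} [MeasurableSpace Ξ] {D : Measure Ξ} {F : A.Params → Ξ → ℝ}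
  {σ : Fin A.N → ℝ} {Ω : Type*} [MeasurableSpace Ω] {μ : Measure Ω} [IsProbabilityMeasure μ]
  [IsProbabilityMeasure D] {ξ : ℕ → ℕ → Ω → Ξ}

theorem integral_inner_sampleNoise_past (hF : StochasticGradient D F σ)
    (hc : Continuous (gradient (objective D F))) (hξ : IIDSamples D μ ξ) {I : Set (ℕ × ℕ)}
    {t b : ℕ} (hI : (t, b) ∉ I) {X Y : Ω → A.Params} (hX : Measurable[sampleAlgebra ξ I] X)
    (hY : Measurable[sampleAlgebra ξ I] Y) (hY2 : MemLp Y 2 μ) :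
    ∫ ω, inner ℝ (Y ω) (sampleNoise D F (X ω) (ξ t b ω)) ∂μ = 0 :=
  integral_inner_sampleNoise_comp hF hc (hX.mono (hξ.sampleAlgebra_le I) le_rfl)
    (hY.mono (hξ.sampleAlgebra_le I) le_rfl) (hξ.measurable t b) (hξ.law t b)
    (hξ.indepFun hI (hY.prodMk hX)) hY2

theorem memLp_sampleNoise_past (hF : StochasticGradient D F σ)
    (hc : Continuous (gradient (objective D F))) (hξ : IIDSamples D μ ξ) {I : Set (ℕ × ℕ)}
    {t b : ℕ} (hI : (t, b) ∉ I) {X : Ω → A.Params} (hX : Measurable[sampleAlgebra ξ I] X) :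
    MemLp (fun ω => sampleNoise D F (X ω) (ξ t b ω)) 2 μ ∧
      ∫ ω, ‖sampleNoise D F (X ω) (ξ t b ω)‖ ^ 2 ∂μ ≤ totalSigma σ ^ 2 :=
  memLp_sampleNoise_comp hF hc (hX.mono (hξ.sampleAlgebra_le I) le_rfl) (hξ.measurable t b)
    (hξ.law t b) (hξ.indepFun hI hX)

theorem notMem_before (t j : ℕ) {b : ℕ} (h : j ≤ b) : (t, b) ∉ before t j := by
  rintro (h' | ⟨-, h'⟩)
  · exact absurd h' (lt_irrefl t)
  · exact absurd h' (not_lt.2 h)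

/-- The variances of the samples of a batch add up. -/
theorem memLp_sum_sampleNoise (hF : StochasticGradient D F σ)
    (hc : Continuous (gradient (objective D F))) (hξ : IIDSamples D μ ξ) {t : ℕ}
    {X : Ω → A.Params} (hX : Measurable[sampleAlgebra ξ (before t 0)] X) (j : ℕ) :
    MemLp (fun ω => ∑ b ∈ Finset.range j, sampleNoise D F (X ω) (ξ t b ω)) 2 μ ∧
      ∫ ω, ‖∑ b ∈ Finset.range j, sampleNoise D F (X ω) (ξ t b ω)‖ ^ 2 ∂μ ≤
        j * totalSigma σ ^ 2 := by
  induction j with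
  | zero => simp
  | succ j ih =>
    have hX' : Measurable[sampleAlgebra ξ (before t j)] X :=
      hX.mono (sampleAlgebra_mono fun q hq => by
        rcases hq with h | ⟨-, h⟩
        · exact Or.inl h
        · exact absurd h (Nat.not_lt_zero _)) le_rfl
    -- The partial sum depends only on samples preceding sample `j`, so its cross term with the next
    -- noise vanishes.
    have hS : Measurable[sampleAlgebra ξ (before t j)]
        fun ω => ∑ b ∈ Finset.range j, sampleNoise D F (X ω) (ξ t b ω) := by
      refine Finset.measurable_fun_sum _ fun b hb => ?_
      exact measurable_sampleNoise_comp hF hc hX'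
        (measurable_sampleAlgebra (Or.inr ⟨rfl, Finset.mem_range.1 hb⟩))
    have hn := memLp_sampleNoise_past hF hc hξ (notMem_before t j le_rfl) hX'
    have ho := integral_inner_sampleNoise_past hF hc hξ (notMem_before t j le_rfl) hX' hS ih.1
    simp_rw [Finset.sum_range_succ]
    refine ⟨ih.1.add hn.1, ?_⟩
    have i1 := integrable_norm_sq ih.1
    have i2 := (integrable_inner_of_memLp ih.1 hn.1).const_mul 2
    have i3 := integrable_norm_sq hn.1
    simp_rw [norm_add_sq_real]
    rw [integral_add (f := fun ω => ‖∑ b ∈ Finset.range j, sampleNoise D F (X ω) (ξ t b ω)‖ ^ 2 +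
      2 * inner ℝ (∑ b ∈ Finset.range j, sampleNoise D F (X ω) (ξ t b ω))
        (sampleNoise D F (X ω) (ξ t j ω))) (i1.add i2) i3,
      integral_add i1 i2, integral_const_mul, ho]
    push_cast
    linarith [ih.2, hn.2]

theorem integral_inner_sum_sampleNoise (hF : StochasticGradient D F σ)
    (hc : Continuous (gradient (objective D F))) (hξ : IIDSamples D μ ξ) {t : ℕ}
    {X Y : Ω → A.Params} (hX : Measurable[sampleAlgebra ξ (before t 0)] X)
    (hY : Measurable[sampleAlgebra ξ (before t 0)] Y) (hY2 : MemLp Y 2 μ) (j : ℕ) :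
    ∫ ω, inner ℝ (Y ω) (∑ b ∈ Finset.range j, sampleNoise D F (X ω) (ξ t b ω)) ∂μ = 0 := by
  simp_rw [inner_sum]
  rw [integral_finsetSum _ fun b _ => integrable_inner_of_memLp hY2
    (memLp_sampleNoise_past hF hc hξ (notMem_before t 0 (Nat.zero_le b)) hX).1]
  exact Finset.sum_eq_zero fun b _ =>
    integral_inner_sampleNoise_past hF hc hξ (notMem_before t 0 (Nat.zero_le b)) hX hY hY2

end Batch

/-! ### Measurability of the algorithm -/

section Measurability

variable {Ω : Type*} {mΩ : MeasurableSpace Ω}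

/-- Entrywise measurability of a random matrix. -/
def EntryMeasurable {m n : ℕ} (mΩ : MeasurableSpace Ω) (M : Ω → Matrix (Fin m) (Fin n) ℝ) : Prop :=
  ∀ i j, Measurable[mΩ] fun ω => M ω i j

theorem EntryMeasurable.mul {m n k : ℕ} {M : Ω → Matrix (Fin m) (Fin n) ℝ}
    {M' : Ω → Matrix (Fin n) (Fin k) ℝ} (h : EntryMeasurable mΩ M) (h' : EntryMeasurable mΩ M') :
    EntryMeasurable mΩ fun ω => M ω * M' ω := fun i j => by
  simp only [Matrix.mul_apply]
  exact Finset.measurable_fun_sum _ fun k _ => (h i k).mul (h' k j)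

theorem EntryMeasurable.transpose {m n : ℕ} {M : Ω → Matrix (Fin m) (Fin n) ℝ}
    (h : EntryMeasurable mΩ M) : EntryMeasurable mΩ fun ω => (M ω).transpose := fun i j => h j i

theorem EntryMeasurable.add {m n : ℕ} {M M' : Ω → Matrix (Fin m) (Fin n) ℝ}
    (h : EntryMeasurable mΩ M) (h' : EntryMeasurable mΩ M') :
    EntryMeasurable mΩ fun ω => M ω + M' ω := fun i j => (h i j).add (h' i j)

theorem EntryMeasurable.sub {m n : ℕ} {M M' : Ω → Matrix (Fin m) (Fin n) ℝ}
    (h : EntryMeasurable mΩ M) (h' : EntryMeasurable mΩ M') :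
    EntryMeasurable mΩ fun ω => M ω - M' ω := fun i j => (h i j).sub (h' i j)

theorem EntryMeasurable.smul {m n : ℕ} {M : Ω → Matrix (Fin m) (Fin n) ℝ}
    (h : EntryMeasurable mΩ M) (a : ℝ) : EntryMeasurable mΩ fun ω => a • M ω :=
  fun i j => (h i j).const_mul a

theorem EntryMeasurable.sum {m n : ℕ} {ι : Type*} {I : Finset ι}
    {M : ι → Ω → Matrix (Fin m) (Fin n) ℝ} (h : ∀ b ∈ I, EntryMeasurable mΩ (M b)) :
    EntryMeasurable mΩ fun ω => ∑ b ∈ I, M b ω := fun i j => by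
  simp only [Matrix.sum_apply]
  exact Finset.measurable_fun_sum _ fun b hb => h b hb i j

theorem EntryMeasurable.firstCols {m r : ℕ} (h : r ≤ m) {U : Ω → Matrix (Fin m) (Fin m) ℝ}
    (hU : EntryMeasurable mΩ U) : EntryMeasurable mΩ fun ω => GaLore.firstCols h (U ω) :=
  fun i j => hU i (Fin.castLE h j)

/-- Measurability of a random layer memory. -/
structure MemMeasurable {m n r : ℕ} (mΩ : MeasurableSpace Ω) (c : Ω → LayerMem m n r) : Prop where
  P : EntryMeasurable mΩ fun ω => (c ω).P
  Q : EntryMeasurable mΩ fun ω => (c ω).Q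
  Mleft : EntryMeasurable mΩ fun ω => (c ω).Mleft
  Mright : EntryMeasurable mΩ fun ω => (c ω).Mright

theorem MemMeasurable.update {m n r : ℕ} (h : r ≤ min m n) (H : Hyper) (t : ℕ)
    {G : Ω → Matrix (Fin m) (Fin n) ℝ} {s : Ω → SVDFactors m n} {c : Ω → LayerMem m n r}
    (hG : EntryMeasurable mΩ G) (hU : EntryMeasurable mΩ fun ω => (s ω).U)
    (hV : EntryMeasurable mΩ fun ω => (s ω).V) (hc : MemMeasurable mΩ c) :
    MemMeasurable mΩ fun ω => updateMem h H t (G ω) (s ω) (c ω) := by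
  unfold updateMem
  split_ifs
  · have hP := hU.firstCols (h.trans (min_le_left m n))
    exact ⟨hP, hc.Q, (((hP.transpose.mul hc.P).mul hc.Mleft).smul _).add
      ((hP.transpose.mul hG).smul _), hc.Mright⟩
  · have hQ := hV.firstCols (h.trans (min_le_right m n))
    exact ⟨hc.P, hQ, hc.Mleft, (((hc.Mright.mul hc.Q.transpose).mul hQ).smul _).add
      ((hG.mul hQ).smul _)⟩
  · exact ⟨hc.P, hc.Q, (hc.Mleft.smul _).add ((hc.P.transpose.mul hG).smul _), hc.Mright⟩
  · exact ⟨hc.P, hc.Q, hc.Mleft, (hc.Mright.smul _).add ((hG.mul hc.Q).smul _)⟩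

theorem MemMeasurable.direction {m n r : ℕ} {c : Ω → LayerMem m n r} (hc : MemMeasurable mΩ c) :
    EntryMeasurable mΩ fun ω => (c ω).direction := by
  unfold LayerMem.direction
  split_ifs
  · exact hc.P.mul hc.Mleft
  · exact hc.Mright.mul hc.Q.transpose

theorem MemMeasurable.proj {m n r : ℕ} {c : Ω → LayerMem m n r} (hc : MemMeasurable mΩ c)
    {G : Ω → Matrix (Fin m) (Fin n) ℝ} (hG : EntryMeasurable mΩ G) :
    EntryMeasurable mΩ fun ω => (c ω).proj (G ω) := by
  unfold LayerMem.proj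
  split_ifs
  · exact (hc.P.mul hc.P.transpose).mul hG
  · exact hG.mul (hc.Q.mul hc.Q.transpose)

variable {A : Arch}

theorem measurable_ofLayers {X : Ω → ∀ l : Fin A.N, Matrix (Fin (A.m l)) (Fin (A.n l)) ℝ}
    (h : ∀ l, EntryMeasurable mΩ fun ω => X ω l) : Measurable fun ω => ofLayers (X ω) :=
  measurable_params fun q => h q.1 q.2.1 q.2.2

theorem entryMeasurable_layer {x : Ω → A.Params} (h : Measurable x) (l : Fin A.N) :
    EntryMeasurable mΩ fun ω => layer (x ω) l := fun i j => measurable_coord h ⟨l, i, j⟩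

theorem measurable_memProj {mem : Ω → ∀ l : Fin A.N, LayerMem (A.m l) (A.n l) (A.r l)}
    (h : ∀ l, MemMeasurable mΩ fun ω => mem ω l) {v : Ω → A.Params} (hv : Measurable v) :
    Measurable fun ω => memProj (mem ω) (v ω) :=
  measurable_ofLayers fun l => (h l).proj (entryMeasurable_layer hv l)

theorem measurable_memDirection {mem : Ω → ∀ l : Fin A.N, LayerMem (A.m l) (A.n l) (A.r l)}
    (h : ∀ l, MemMeasurable mΩ fun ω => mem ω l) : Measurable fun ω => memDirection (mem ω) :=
  measurable_ofLayers fun l => (h l).direction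

/-- Measurability of a random state. -/
structure StateMeasurable (mΩ : MeasurableSpace Ω) (s : Ω → State A) : Prop where
  x : Measurable[mΩ] fun ω => (s ω).x
  mem : ∀ l, MemMeasurable mΩ fun ω => (s ω).mem l

variable {Ξ : Type*} [MeasurableSpace Ξ] {F : A.Params → Ξ → ℝ}

theorem entryMeasurable_gradEst (hm : ∀ x, Measurable (F x))
    (hd : ∀ z, Differentiable ℝ fun x => F x z) (H : Hyper) (t : ℕ) {x : Ω → A.Params}
    (hx : Measurable x) {z : Ω → ℕ → Ξ} (hz : ∀ b, Measurable fun ω => z ω b) (l : Fin A.N) :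
    EntryMeasurable mΩ fun ω => gradEst H F t (x ω) (z ω) l := by
  have h : ∀ b, EntryMeasurable mΩ fun ω => layerGrad (fun y => F y (z ω b)) (x ω) l := fun b =>
    entryMeasurable_layer ((measurable_gradient_uncurry hm hd).comp (hx.prodMk (hz b))) l
  unfold gradEst
  split_ifs
  · exact (EntryMeasurable.sum fun b _ => h b).smul _
  · exact h 0

theorem SVDRule.Valid.entryMeasurable {svd : SVDRule A} (hs : svd.Valid) (t : ℕ) (l : Fin A.N)
    {G : Ω → Matrix (Fin (A.m l)) (Fin (A.n l)) ℝ} (hG : EntryMeasurable mΩ G) :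
    (EntryMeasurable mΩ fun ω => (svd t l (G ω)).U) ∧
      EntryMeasurable mΩ fun ω => (svd t l (G ω)).V := by
  have h : Measurable fun (ω : Ω) (i : Fin (A.m l)) (j : Fin (A.n l)) => G ω i j :=
    measurable_pi_lambda _ fun i => measurable_pi_lambda _ fun j => hG i j
  exact ⟨fun i k => (hs.measurable_U t l i k).comp h, fun j k => (hs.measurable_V t l j k).comp h⟩

theorem StateMeasurable.step (hm : ∀ x, Measurable (F x))
    (hd : ∀ z, Differentiable ℝ fun x => F x z) {svd : SVDRule A} (hs : svd.Valid) (H : Hyper)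
    (t : ℕ) {z : Ω → ℕ → Ξ} (hz : ∀ b, Measurable fun ω => z ω b) {s : Ω → State A}
    (h : StateMeasurable mΩ s) :
    StateMeasurable mΩ fun ω => GaLore.step H F svd t (z ω) (s ω) := by
  have hmem : ∀ l, MemMeasurable mΩ fun ω => (GaLore.step H F svd t (z ω) (s ω)).mem l :=
      fun l => by
    have hG := entryMeasurable_gradEst hm hd H t h.x hz l
    exact (h.mem l).update (A.r_le l) H t hG (hs.entryMeasurable t l hG).1
      (hs.entryMeasurable t l hG).2
  exact ⟨measurable_ofLayers fun l => (entryMeasurable_layer h.x l).sub ((hmem l).direction.smul _),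
    hmem⟩

/-- The σ-algebra is arbitrary: it is taken to be that of the samples before iteration `t` for
orthogonality, and the full one for the measurability of projections. -/
theorem stateMeasurable_run (hm : ∀ x, Measurable (F x))
    (hd : ∀ z, Differentiable ℝ fun x => F x z) {svd : SVDRule A} (hs : svd.Valid) (H : Hyper)
    (x0 : A.Params) {z : Ω → ℕ → ℕ → Ξ} (t : ℕ) (hz : ∀ i < t, ∀ b, Measurable fun ω => z ω i b) :
    StateMeasurable mΩ fun ω => run H F svd x0 (z ω) t := by
  induction t with
  | zero =>
    exact ⟨measurable_const, fun l => ⟨fun _ _ => measurable_const, fun _ _ => measurable_const,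
      fun _ _ => measurable_const, fun _ _ => measurable_const⟩⟩
  | succ t ih =>
    exact StateMeasurable.step hm hd hs H t (hz t (Nat.lt_succ_self t))
      (ih fun i hi => hz i (Nat.lt_succ_of_lt hi))

end Measurability

/-! ### GaLore as a projected momentum method -/

section Estimate

variable {A : Arch} {Ξ : Type*} {F : A.Params → Ξ → ℝ} {H : Hyper}

theorem gradEstVec_of_switch {t : ℕ} (ht : t % H.τ = 0) (x : A.Params) (z : ℕ → Ξ) :
    gradEstVec H F t x z =
      (1 / (H.B : ℝ)) • ∑ b ∈ Finset.range H.B, gradient (fun y => F y (z b)) x := by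
  ext ⟨l, i, j⟩
  simp [gradEstVec, gradEst, ofLayers, ht, layerGrad, layer, Matrix.sum_apply]

variable [MeasurableSpace Ξ] {D : Measure Ξ}

theorem gradEstVec_sub_of_switch {t : ℕ} (ht : t % H.τ = 0) (hB : 1 ≤ H.B) (x : A.Params)
    (z : ℕ → Ξ) : gradEstVec H F t x z - gradient (objective D F) x =
      (1 / (H.B : ℝ)) • ∑ b ∈ Finset.range H.B, sampleNoise D F x (z b) := by
  have hB' : (H.B : ℝ) ≠ 0 := by positivity
  rw [gradEstVec_of_switch ht]
  unfold sampleNoise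
  rw [Finset.sum_sub_distrib, Finset.sum_const, Finset.card_range, smul_sub,
    ← Nat.cast_smul_eq_nsmul ℝ, smul_smul, one_div_mul_cancel hB', one_smul]

theorem gradEstVec_sub_of_not_switch {t : ℕ} (ht : t % H.τ ≠ 0) (x : A.Params)
    (z : ℕ → Ξ) : gradEstVec H F t x z - gradient (objective D F) x = sampleNoise D F x (z 0) := by
  have : gradEstVec H F t x z = gradient (fun y => F y (z 0)) x := by
    ext ⟨l, i, j⟩
    simp [gradEstVec, gradEst, ofLayers, ht, layerGrad, layer]
  unfold sampleNoise
  rw [this]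

end Estimate

section Main

variable {A : Arch} {Ξ : Type*} [MeasurableSpace Ξ] {D : Measure Ξ} {F : A.Params → Ξ → ℝ}
  {σ : Fin A.N → ℝ} {Ω : Type*} [mΩ : MeasurableSpace Ω] {μ : Measure Ω} [IsProbabilityMeasure μ]
  [IsProbabilityMeasure D] {ξ : ℕ → ℕ → Ω → Ξ} {L : ℝ} {svd : SVDRule A} {H : Hyper}

theorem projectedMomentum_run (hsm : LSmooth (objective D F) L) (hF : StochasticGradient D F σ)
    (hs : svd.Valid) (hξ : IIDSamples D μ ξ) (hB : 1 ≤ H.B) (x0 : A.Params) :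
    ProjectedMomentum μ (objective D F) x0 H.β H.η A.minDelta (totalSigma σ ^ 2)
      (totalSigma σ ^ 2 / H.B) H.τ (iterate H F svd x0 ξ)
      (fun t ω => memDirection (run H F svd x0 (fun i b => ξ i b ω) t).mem)
      (fun t ω => gradEstVec H F t (iterate H F svd x0 ξ t ω) (fun b => ξ t b ω) -
        gradient (objective D F) (iterate H F svd x0 ξ t ω))
      (fun t ω => memProj (run H F svd x0 (fun i b => ξ i b ω) t).mem) := by
  have hc := continuous_gradient_of_lipschitz hsm.2
  have hB' : (1 : ℝ) ≤ H.B := by exact_mod_cast hB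
  have hstate : ∀ t, StateMeasurable (sampleAlgebra ξ (before t 0))
      fun ω => run H F svd x0 (fun i b => ξ i b ω) t := fun t =>
    stateMeasurable_run hF.measurable hF.differentiable hs H x0 t fun i hi b =>
      measurable_sampleAlgebra (Or.inl hi)
  have hX : ∀ t, Measurable[sampleAlgebra ξ (before t 0)] (iterate H F svd x0 ξ t) := fun t =>
    (hstate t).x
  have hm : ∀ t, Measurable[sampleAlgebra ξ (before t 0)]
      fun ω => memDirection (run H F svd x0 (fun i b => ξ i b ω) t).mem := fun t =>
    measurable_memDirection (hstate t).mem
  have hg : ∀ t, Measurable[sampleAlgebra ξ (before t 0)]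
      fun ω => gradient (objective D F) (iterate H F svd x0 ξ t ω) := fun t =>
    hc.measurable.comp (hX t)
  have hnoise : ∀ t, MemLp (fun ω => gradEstVec H F t (iterate H F svd x0 ξ t ω)
      (fun b => ξ t b ω) - gradient (objective D F) (iterate H F svd x0 ξ t ω)) 2 μ ∧
      ∫ ω, ‖gradEstVec H F t (iterate H F svd x0 ξ t ω) (fun b => ξ t b ω) -
        gradient (objective D F) (iterate H F svd x0 ξ t ω)‖ ^ 2 ∂μ ≤
        if t % H.τ = 0 then totalSigma σ ^ 2 / H.B else totalSigma σ ^ 2 := by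
    intro t
    split_ifs with ht
    · simp_rw [gradEstVec_sub_of_switch ht hB]
      have h := memLp_sum_sampleNoise hF hc hξ (hX t) H.B
      refine ⟨h.1.const_smul (1 / (H.B : ℝ)), ?_⟩
      simp_rw [norm_smul, mul_pow]
      rw [integral_const_mul]
      refine (mul_le_mul_of_nonneg_left h.2 (sq_nonneg _)).trans_eq ?_
      rw [Real.norm_of_nonneg (by positivity)]
      field_simp
    · simp_rw [gradEstVec_sub_of_not_switch ht]
      exact memLp_sampleNoise_past hF hc hξ (notMem_before t 0 le_rfl) (hX t)
  refine
    { X_zero := fun _ => rfl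
      m_zero := fun _ => memDirection_run_zero
      p_zero := fun _ => memProj_run_zero
      proj := fun t ω => memProj_isSymmetricProjection (run_isPartialIsometry hs.isSVD t)
      X_succ := fun t ω => run_succ_x t
      m_succ := fun t ω => ?_
      p_succ := fun t ω ht => memProj_run_succ ht
      capture := fun t ω ht => ?_
      aestronglyMeasurable_apply := fun t v hv => ?_
      memLp_noise := fun t => (hnoise t).1
      noise_le := fun t => (hnoise t).2.trans ?_
      noise_le_of_switch := fun t ht => (hnoise t).2.trans_eq (if_pos ht)
      orth_of_switch := fun t ht hY => ?_
      orth := fun t ht hY => ?_ }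
  · rw [add_sub_cancel]
    exact memDirection_run_succ hs.isSVD t
  · rw [add_sub_cancel]
    exact run_capture hs.isSVD ht
  · have hmem : ∀ l, MemMeasurable mΩ fun ω => (run H F svd x0 (fun i b => ξ i b ω) t).mem l :=
      (stateMeasurable_run hF.measurable hF.differentiable hs H x0 t fun i _ b =>
        hξ.measurable i b).mem
    -- `v` is only almost everywhere equal to a measurable map, so the projection is applied to that
    -- representative.
    refine ⟨fun ω => memProj (run H F svd x0 (fun i b => ξ i b ω) t).mem (hv.mk v ω),
      (measurable_memProj hmem hv.stronglyMeasurable_mk.measurable).stronglyMeasurable, ?_⟩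
    filter_upwards [hv.ae_eq_mk] with ω hω
    rw [hω]
  · split_ifs
    · exact div_le_self (sq_nonneg _) hB'
    · exact le_rfl
  · simp_rw [gradEstVec_sub_of_switch ht hB, inner_smul_right]
    rw [integral_const_mul]
    have := integral_inner_sum_sampleNoise hF hc hξ (hX t) ((hm t).sub (hg t)) hY H.B
    exact mul_eq_zero_of_right _ this
  · simp_rw [gradEstVec_sub_of_not_switch ht]
    exact integral_inner_sampleNoise_past hF hc hξ (notMem_before t 0 le_rfl) (hX t)
      ((hm t).sub (measurable_memProj (hstate t).mem (hg t))) hY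

end Main

/-! ### The bound over full periods -/

section Periods

variable {A : Arch} {Ξ : Type*} [MeasurableSpace Ξ] {D : Measure Ξ} {F : A.Params → Ξ → ℝ}
  {σ : Fin A.N → ℝ} {Ω : Type*} [MeasurableSpace Ω] {μ : Measure Ω} [IsProbabilityMeasure μ]
  [IsProbabilityMeasure D] {ξ : ℕ → ℕ → Ω → Ξ} {L : ℝ} {svd : SVDRule A} {H : Hyper}

theorem gap_nonneg {f : A.Params → ℝ} (hb : LowerBounded f) (x0 : A.Params) : 0 ≤ gap f x0 :=
  sub_nonneg.2 (ciInf_le hb x0)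

theorem sq_mul_sq_le_of_le_sqrt {η a L : ℝ} (hη : 0 < η) (hL : 0 < L)
    (h : η ≤ Real.sqrt (a / L ^ 2)) : η ^ 2 * L ^ 2 ≤ a := by
  have h1 : η ^ 2 ≤ a / L ^ 2 := (Real.le_sqrt' hη).1 h
  rwa [le_div_iff₀ (by positivity)] at h1

theorem avgGradSqLE_periods (hL : 0 < L) (hb : LowerBounded (objective D F))
    (hsm : LSmooth (objective D F) L) (hF : StochasticGradient D F σ)
    (hs : svd.Valid) (hξ : IIDSamples D μ ξ) (x0 : A.Params) {K : ℕ}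
    (hβ0 : 0 < H.β) (hβ1 : H.β ≤ 1) (hτ : 64 / (3 * H.β * A.minDelta) ≤ (H.τ : ℝ))
    (hη : 0 < H.η) (hη1 : H.η ≤ 1 / (4 * L))
    (hη2 : H.η ≤ Real.sqrt (3 * A.minDelta * H.β ^ 2 / (80 * L ^ 2)))
    (hη3 : H.η ≤ Real.sqrt (A.minDelta / (40 * (H.τ : ℝ) ^ 2 * L ^ 2)))
    (hη4 : H.η ≤ Real.sqrt (3 * H.β / (32 * (H.τ : ℝ) * L ^ 2)))
    (hB : 1 ≤ H.B) (hK : 1 ≤ K) :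
    AvgGradSqLE μ (objective D F) (iterate H F svd x0 ξ) (K * H.τ)
      (16 * gap (objective D F) x0 / (A.minDelta * H.η * K * H.τ) +
        (160 / (3 * H.β * A.minDelta * H.τ * H.B) + 352 / (3 * A.minDelta ^ 2 * H.B) +
          32 * H.β / (3 * A.minDelta)) * totalSigma σ ^ 2) := by
  have hδ0 := minDelta_pos A
  have hδ1 := minDelta_le_one A
  have hp := projectedMomentum_run hsm hF hs hξ hB x0
  refine ⟨fun t _ => integrable_norm_sq (hp.memLp_grad hsm.2 t), ?_⟩
  have hτ0 : (0 : ℝ) < H.τ := lt_of_lt_of_le (by positivity) hτ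
  have hK0 : (0 : ℝ) < K := by exact_mod_cast hK
  have hB0 : (0 : ℝ) < H.B := by exact_mod_cast hB
  have h2 : H.η ^ 2 * L ^ 2 ≤ 3 * A.minDelta * H.β ^ 2 / 80 := by
    refine sq_mul_sq_le_of_le_sqrt hη hL ?_
    rwa [div_div]
  have h3 : H.η ^ 2 * L ^ 2 * (H.τ : ℝ) ^ 2 ≤ A.minDelta / 40 := by
    have := sq_mul_sq_le_of_le_sqrt (a := A.minDelta / (40 * (H.τ : ℝ) ^ 2)) hη hL
      (by rwa [div_div])
    rw [← div_div, le_div_iff₀ (by positivity)] at this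
    exact this
  have h4 : H.η ^ 2 * L ^ 2 * H.τ ≤ 3 * H.β / 32 := by
    have := sq_mul_sq_le_of_le_sqrt (a := 3 * H.β / (32 * (H.τ : ℝ))) hη hL
      (by rwa [div_div])
    rw [← div_div, le_div_iff₀ hτ0] at this
    exact this
  have key := hp.sum_gradient_le hsm.1 hb hsm.2 hL hβ0 hβ1 hδ0 hδ1 hη (by exact_mod_cast hτ0) hτ
    hη1 h2 h3 h4 hK
  set S := ∑ t ∈ Finset.range (K * H.τ),
    ∫ ω, ‖gradient (objective D F) (iterate H F svd x0 ξ t ω)‖ ^ 2 ∂μ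
  have hΔ := gap_nonneg hb x0
  change _ ≤ gap (objective D F) x0 + _ at key
  set Δ := gap (objective D F) x0
  set δ := A.minDelta
  set s := totalSigma σ ^ 2
  have hs0 : 0 ≤ s := sq_nonneg _
  push_cast
  have e1 : 1 / ((K : ℝ) * H.τ) * S = (8 / (δ * H.η * K * H.τ)) * (H.η * δ / 8 * S) := by
    field_simp
  -- The argument yields the constants `8`, `64` and `4`, smaller than those stated; the steps below
  -- enlarge them.
  have e2 : (8 / (δ * H.η * K * H.τ)) *
      (Δ + H.η / 2 * ((16 / δ * (s / H.B) + H.β * s) * (K * H.τ))) =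
      8 * Δ / (δ * H.η * K * H.τ) + (64 / (δ ^ 2 * H.B) + 4 * H.β / δ) * s := by
    field_simp; ring
  rw [e1]
  refine (mul_le_mul_of_nonneg_left key (by positivity)).trans (e2.trans_le ?_)
  have b1 : 8 * Δ / (δ * H.η * K * H.τ) ≤ 16 * Δ / (δ * H.η * K * H.τ) := by gcongr; norm_num
  have b2 : 64 / (δ ^ 2 * H.B) ≤ 352 / (3 * δ ^ 2 * H.B) := by
    rw [div_le_div_iff₀ (by positivity) (by positivity)]
    nlinarith [mul_pos (pow_pos hδ0 2) hB0]
  have b3 : 4 * H.β / δ ≤ 32 * H.β / (3 * δ) := by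
    rw [div_le_div_iff₀ (by positivity) (by positivity)]
    nlinarith [mul_pos hβ0 hδ0]
  have b4 : 0 ≤ 160 / (3 * H.β * δ * H.τ * H.B) := by positivity
  have b5 : (64 / (δ ^ 2 * H.B) + 4 * H.β / δ) * s ≤ (160 / (3 * H.β * δ * H.τ * H.B) +
      352 / (3 * δ ^ 2 * H.B) + 32 * H.β / (3 * δ)) * s :=
    mul_le_mul_of_nonneg_right (by linarith) hs0
  linarith

end Periods

/-! ### Hyperparameters for a given horizon -/

section Horizon

/-- Turns half-integer powers of `δ` into natural powers of `√δ`, on which rational simplification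
works. -/
theorem rpow_div_two {δ : ℝ} (hδ : 0 ≤ δ) (k : ℕ) : δ ^ ((k : ℝ) / 2) = Real.sqrt δ ^ k := by
  rw [Real.sqrt_eq_rpow, ← Real.rpow_natCast, ← Real.rpow_mul hδ]
  congr 1; ring

/-- The quantity `√(δ^(3/2) σ² T / (L Δ))`, for which `β = (1 + q)⁻¹`. -/
noncomputable def noiseRatio (δ L Δ σ : ℝ) (T : ℕ) : ℝ :=
  Real.sqrt (δ ^ (3 / 2 : ℝ) * σ ^ 2 * T / (L * Δ))

variable {δ L Δ σ : ℝ} {T : ℕ}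

theorem noiseRatio_sq (hδ0 : 0 < δ) (hL : 0 < L) (hΔ : 0 < Δ) :
    noiseRatio δ L Δ σ T ^ 2 = Real.sqrt δ ^ 3 * σ ^ 2 * T / (L * Δ) := by
  have e : δ ^ (3 / 2 : ℝ) = Real.sqrt δ ^ 3 := by
    rw [← rpow_div_two hδ0.le]; norm_num
  unfold noiseRatio
  rw [Real.sq_sqrt (by positivity), e]

theorem noiseRatio_nonneg : 0 ≤ noiseRatio δ L Δ σ T := Real.sqrt_nonneg _

theorem hyperFor_beta : (hyperFor δ L Δ σ T).β = (1 + noiseRatio δ L Δ σ T)⁻¹ := rfl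

theorem hyperFor_tau :
    (hyperFor δ L Δ σ T).τ = ⌈64 / (3 * δ * (hyperFor δ L Δ σ T).β)⌉₊ := rfl

theorem hyperFor_B : (hyperFor δ L Δ σ T).B = ⌈1 / (δ * (hyperFor δ L Δ σ T).β)⌉₊ := rfl

theorem hyperFor_eta :
    (hyperFor δ L Δ σ T).η =
      (4 * L + Real.sqrt (80 * L ^ 2 / (3 * δ * (hyperFor δ L Δ σ T).β ^ 2)) +
      Real.sqrt (40 * ((hyperFor δ L Δ σ T).τ : ℝ) ^ 2 * L ^ 2 / δ) +
      Real.sqrt (32 * ((hyperFor δ L Δ σ T).τ : ℝ) * L ^ 2 / (3 * (hyperFor δ L Δ σ T).β)))⁻¹ :=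
  rfl

theorem hyperFor_beta_pos : 0 < (hyperFor δ L Δ σ T).β := by
  rw [hyperFor_beta]
  have := noiseRatio_nonneg (δ := δ) (L := L) (Δ := Δ) (σ := σ) (T := T)
  positivity

theorem hyperFor_beta_le_one : (hyperFor δ L Δ σ T).β ≤ 1 := by
  rw [hyperFor_beta]
  have := noiseRatio_nonneg (δ := δ) (L := L) (Δ := Δ) (σ := σ) (T := T)
  exact inv_le_one_of_one_le₀ (by linarith)

theorem le_hyperFor_tau :
    64 / (3 * (hyperFor δ L Δ σ T).β * δ) ≤ ((hyperFor δ L Δ σ T).τ : ℝ) := by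
  rw [mul_right_comm]
  exact Nat.le_ceil _

theorem hyperFor_tau_pos (hδ0 : 0 < δ) : 0 < (hyperFor δ L Δ σ T).τ := by
  rw [hyperFor_tau]
  have := hyperFor_beta_pos (δ := δ) (L := L) (Δ := Δ) (σ := σ) (T := T)
  exact Nat.ceil_pos.2 (by positivity)

theorem one_le_hyperFor_B (hδ0 : 0 < δ) : 1 ≤ (hyperFor δ L Δ σ T).B := by
  rw [hyperFor_B]
  have := hyperFor_beta_pos (δ := δ) (L := L) (Δ := Δ) (σ := σ) (T := T)
  exact Nat.ceil_pos.2 (by positivity)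

theorem hyperFor_B_le_tau (hδ0 : 0 < δ) : (hyperFor δ L Δ σ T).B ≤ (hyperFor δ L Δ σ T).τ := by
  rw [hyperFor_B, hyperFor_tau]
  have := hyperFor_beta_pos (δ := δ) (L := L) (Δ := Δ) (σ := σ) (T := T)
  refine Nat.ceil_mono ?_
  rw [div_le_div_iff₀ (by positivity) (by positivity)]
  nlinarith [mul_pos hδ0 this]

theorem hyperFor_tau_le (hδ0 : 0 < δ) (hδ1 : δ ≤ 1) :
    ((hyperFor δ L Δ σ T).τ : ℝ) ≤ 23 / (δ * (hyperFor δ L Δ σ T).β) := by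
  have h0 := hyperFor_beta_pos (δ := δ) (L := L) (Δ := Δ) (σ := σ) (T := T)
  have h1 := hyperFor_beta_le_one (δ := δ) (L := L) (Δ := Δ) (σ := σ) (T := T)
  have h2 : ((hyperFor δ L Δ σ T).τ : ℝ) < 64 / (3 * δ * (hyperFor δ L Δ σ T).β) + 1 :=
    Nat.ceil_lt_add_one (by positivity)
  -- Absorbs the rounding of the ceiling: `64/3 + 1 ≤ 23`.
  have h3 : 1 ≤ 1 / (δ * (hyperFor δ L Δ σ T).β) := by
    rw [le_div_iff₀ (by positivity), one_mul]
    exact mul_le_one₀ hδ1 h0.le h1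
  have e : 64 / (3 * δ * (hyperFor δ L Δ σ T).β) =
      64 / 3 * (1 / (δ * (hyperFor δ L Δ σ T).β)) := by field_simp
  have e' : 23 / (δ * (hyperFor δ L Δ σ T).β) = 23 * (1 / (δ * (hyperFor δ L Δ σ T).β)) := by ring
  rw [e] at h2
  rw [e']
  linarith

theorem hyperFor_eta_pos (hL : 0 < L) : 0 < (hyperFor δ L Δ σ T).η := by
  rw [hyperFor_eta]
  positivity

/-- The four summands of `η⁻¹` are the reciprocals of the four caps, so `η` lies below each of them.
-/
theorem hyperFor_eta_le (hδ0 : 0 < δ) (hL : 0 < L) :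
    (hyperFor δ L Δ σ T).η ≤ 1 / (4 * L) ∧
    (hyperFor δ L Δ σ T).η ≤
      Real.sqrt (3 * δ * (hyperFor δ L Δ σ T).β ^ 2 / (80 * L ^ 2)) ∧
    (hyperFor δ L Δ σ T).η ≤
      Real.sqrt (δ / (40 * ((hyperFor δ L Δ σ T).τ : ℝ) ^ 2 * L ^ 2)) ∧
    (hyperFor δ L Δ σ T).η ≤ Real.sqrt (3 * (hyperFor δ L Δ σ T).β /
      (32 * ((hyperFor δ L Δ σ T).τ : ℝ) * L ^ 2)) := by
  have hβ := hyperFor_beta_pos (δ := δ) (L := L) (Δ := Δ) (σ := σ) (T := T)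
  have hτ : (0 : ℝ) < (hyperFor δ L Δ σ T).τ := by exact_mod_cast hyperFor_tau_pos hδ0
  rw [hyperFor_eta]
  set β := (hyperFor δ L Δ σ T).β
  set τ := (hyperFor δ L Δ σ T).τ
  have p1 : 0 < 80 * L ^ 2 / (3 * δ * β ^ 2) := by positivity
  have p2 : 0 < 40 * (τ : ℝ) ^ 2 * L ^ 2 / δ := by positivity
  have p3 : 0 < 32 * (τ : ℝ) * L ^ 2 / (3 * β) := by positivity
  have q1 := Real.sqrt_pos.2 p1
  have q2 := Real.sqrt_pos.2 p2
  have q3 := Real.sqrt_pos.2 p3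
  refine ⟨?_, ?_, ?_, ?_⟩
  · rw [one_div]
    exact inv_anti₀ (by positivity) (by linarith)
  · rw [← inv_div (80 * L ^ 2), Real.sqrt_inv]
    exact inv_anti₀ q1 (by linarith)
  · rw [← inv_div (40 * (τ : ℝ) ^ 2 * L ^ 2), Real.sqrt_inv]
    exact inv_anti₀ q2 (by linarith)
  · rw [← inv_div (32 * (τ : ℝ) * L ^ 2), Real.sqrt_inv]
    exact inv_anti₀ q3 (by linarith)

theorem inv_hyperFor_eta_le (hδ0 : 0 < δ) (hδ1 : δ ≤ 1) (hL : 0 < L) :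
    ((hyperFor δ L Δ σ T).η)⁻¹ ≤ 187 * L / (Real.sqrt δ ^ 3 * (hyperFor δ L Δ σ T).β) := by
  have hβ := hyperFor_beta_pos (δ := δ) (L := L) (Δ := Δ) (σ := σ) (T := T)
  have hβ1 := hyperFor_beta_le_one (δ := δ) (L := L) (Δ := Δ) (σ := σ) (T := T)
  have hτ : (0 : ℝ) < (hyperFor δ L Δ σ T).τ := by exact_mod_cast hyperFor_tau_pos hδ0
  have hτ2 := hyperFor_tau_le (L := L) (Δ := Δ) (σ := σ) (T := T) hδ0 hδ1
  rw [hyperFor_eta, inv_inv]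
  set β := (hyperFor δ L Δ σ T).β
  set τ := (hyperFor δ L Δ σ T).τ
  set u := Real.sqrt δ with hu
  have hu0 : 0 < u := Real.sqrt_pos.2 hδ0
  have hu1 : u ≤ 1 := Real.sqrt_le_one.2 hδ1
  have hδ : δ = u ^ 2 := (Real.sq_sqrt hδ0.le).symm
  rw [hδ] at hτ2 ⊢
  -- The four summands are at most `4Z`, `6Z`, `161Z` and `16Z`, which gives `187`; here `161 = 7 *
  -- 23` with `40 ≤ 7²`.
  set Z := L / (u ^ 3 * β) with hZ
  have hZ0 : 0 < Z := by positivity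
  have hc1 : u ^ 3 * β ≤ 1 := mul_le_one₀ (pow_le_one₀ hu0.le hu1) hβ.le hβ1
  have b1 : L ≤ Z := by
    rw [hZ, le_div_iff₀ (by positivity)]
    nlinarith
  have b0 : L / (u * β) ≤ Z := by
    rw [hZ]
    gcongr
    calc u ^ 3 ≤ u ^ 1 := pow_le_pow_of_le_one hu0.le hu1 (by norm_num)
      _ = u := pow_one u
  have b2 : Real.sqrt (80 * L ^ 2 / (3 * u ^ 2 * β ^ 2)) ≤ 6 * (L / (u * β)) := by
    rw [Real.sqrt_le_left (by positivity)]
    have e : 80 * L ^ 2 / (3 * u ^ 2 * β ^ 2) = 80 / 3 * (L / (u * β)) ^ 2 := by field_simp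
    rw [e]
    nlinarith [sq_nonneg (L / (u * β))]
  have b3 : Real.sqrt (40 * (τ : ℝ) ^ 2 * L ^ 2 / u ^ 2) ≤ 161 * Z := by
    rw [Real.sqrt_le_left (by positivity)]
    have e : 40 * (τ : ℝ) ^ 2 * L ^ 2 / u ^ 2 = 40 * (τ * (L / u)) ^ 2 := by field_simp
    have e2 : τ * (L / u) ≤ 23 * Z := by
      calc τ * (L / u) ≤ 23 / (u ^ 2 * β) * (L / u) := by gcongr
        _ = 23 * Z := by rw [hZ]; field_simp
    rw [e]
    have := pow_le_pow_left₀ (by positivity) e2 2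
    nlinarith [sq_nonneg Z]
  have b4 : Real.sqrt (32 * (τ : ℝ) * L ^ 2 / (3 * β)) ≤ 16 * (L / (u * β)) := by
    rw [Real.sqrt_le_left (by positivity)]
    calc 32 * (τ : ℝ) * L ^ 2 / (3 * β) ≤ 32 * (23 / (u ^ 2 * β)) * L ^ 2 / (3 * β) := by gcongr
      _ = 736 / 3 * (L / (u * β)) ^ 2 := by field_simp; norm_num
      _ ≤ (16 * (L / (u * β))) ^ 2 := by nlinarith [sq_nonneg (L / (u * β))]
  have e : 187 * L / (u ^ 3 * β) = 187 * Z := by rw [hZ]; ring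
  rw [e]
  linarith

theorem LongHorizon.two_le (h : LongHorizon δ L Δ σ T) (hδ0 : 0 < δ) (hL : 0 < L) (hΔ : 0 < Δ) :
    (2 : ℝ) ≤ T := by
  unfold LongHorizon at h
  have h1 : 0 < 128 / (3 * δ) := by positivity
  have h2 : 0 ≤ (128 * σ) ^ 2 / (9 * Real.sqrt δ * L * Δ) := by positivity
  linarith

theorem LongHorizon.tau_le (h : LongHorizon δ L Δ σ T) (hδ0 : 0 < δ) (hL : 0 < L) (hΔ : 0 < Δ) :
    (hyperFor δ L Δ σ T).τ ≤ T := by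
  have hβ := hyperFor_beta_pos (δ := δ) (L := L) (Δ := Δ) (σ := σ) (T := T)
  have h2 : ((hyperFor δ L Δ σ T).τ : ℝ) < 64 / (3 * δ * (hyperFor δ L Δ σ T).β) + 1 :=
    Nat.ceil_lt_add_one (by positivity)
  have hq := noiseRatio_sq (σ := σ) (T := T) hδ0 hL hΔ
  have hq0 := noiseRatio_nonneg (δ := δ) (L := L) (Δ := Δ) (σ := σ) (T := T)
  have e : 64 / (3 * δ * (hyperFor δ L Δ σ T).β) =
      128 / (3 * δ) / 2 + 128 / (3 * δ) / 2 * noiseRatio δ L Δ σ T := by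
    rw [hyperFor_beta]
    field_simp
    ring
  unfold LongHorizon at h
  rw [e] at h2
  have hT := Nat.cast_nonneg (α := ℝ) T
  set u := Real.sqrt δ
  have hu0 : 0 < u := Real.sqrt_pos.2 hδ0
  have hδ : δ = u ^ 2 := (Real.sq_sqrt hδ0.le).symm
  set b := (128 * σ) ^ 2 / (9 * u * L * Δ) with hb
  have hb0 : 0 ≤ b := by positivity
  have e2 : (128 / (3 * δ) / 2 * noiseRatio δ L Δ σ T) ^ 2 = b * T / 4 := by
    rw [mul_pow, hq, hδ, hb]
    field_simp
    ring
  -- The inequality `√(bT) ≤ (b + T)/2`. With `2 + 128/(3δ) + b ≤ T` it leaves `τ ≤ 3T/4`.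
  have b1 : 128 / (3 * δ) / 2 * noiseRatio δ L Δ σ T ≤ (b + T) / 4 := by
    refine le_of_sq_le_sq ?_ (by positivity)
    rw [e2]
    nlinarith [sq_nonneg (b - T)]
  have : ((hyperFor δ L Δ σ T).τ : ℝ) ≤ T := by linarith
  exact_mod_cast this

/-- The bound over `K` periods covering the horizon, in terms of the horizon. -/
theorem hyperFor_bound_le (h : LongHorizon δ L Δ σ T) (hδ0 : 0 < δ) (hδ1 : δ ≤ 1) (hL : 0 < L)
    (hΔ : 0 < Δ) {K : ℕ} (hK : 0 < K)
    (hK2 : (K : ℝ) * (hyperFor δ L Δ σ T).τ ≤ 2 * T) :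
    (K * (hyperFor δ L Δ σ T).τ) / T *
      (16 * Δ / (δ * (hyperFor δ L Δ σ T).η * K * (hyperFor δ L Δ σ T).τ) +
        (160 / (3 * (hyperFor δ L Δ σ T).β * δ * (hyperFor δ L Δ σ T).τ * (hyperFor δ L Δ σ T).B) +
          352 / (3 * δ ^ 2 * (hyperFor δ L Δ σ T).B) +
          32 * (hyperFor δ L Δ σ T).β / (3 * δ)) * σ ^ 2) ≤
      3300 * (L * Δ / (δ ^ (5 / 2 : ℝ) * T) +
        Real.sqrt (L * Δ * σ ^ 2 / (δ ^ (7 / 2 : ℝ) * T))) := by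
  have hβ := hyperFor_beta_pos (δ := δ) (L := L) (Δ := Δ) (σ := σ) (T := T)
  have hβ1 := hyperFor_beta_le_one (δ := δ) (L := L) (Δ := Δ) (σ := σ) (T := T)
  have hβq := hyperFor_beta (δ := δ) (L := L) (Δ := Δ) (σ := σ) (T := T)
  have hτ : (0 : ℝ) < (hyperFor δ L Δ σ T).τ := by exact_mod_cast hyperFor_tau_pos hδ0
  have hτ1 := le_hyperFor_tau (δ := δ) (L := L) (Δ := Δ) (σ := σ) (T := T)
  have hη := hyperFor_eta_pos (δ := δ) (Δ := Δ) (σ := σ) (T := T) hL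
  have hη1 := inv_hyperFor_eta_le (Δ := Δ) (σ := σ) (T := T) hδ0 hδ1 hL
  have hB : 1 / (δ * (hyperFor δ L Δ σ T).β) ≤ (hyperFor δ L Δ σ T).B := Nat.le_ceil _
  have hB1 : (1 : ℝ) ≤ (hyperFor δ L Δ σ T).B := by exact_mod_cast one_le_hyperFor_B hδ0
  have hT : (0 : ℝ) < T := by linarith [h.two_le hδ0 hL hΔ]
  have hK0 : (0 : ℝ) < K := by exact_mod_cast hK
  have hq := noiseRatio_sq (σ := σ) (T := T) hδ0 hL hΔ
  have hq0 := noiseRatio_nonneg (δ := δ) (L := L) (Δ := Δ) (σ := σ) (T := T)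
  have e5 : δ ^ (5 / 2 : ℝ) = Real.sqrt δ ^ 5 := by
    rw [← rpow_div_two hδ0.le]; norm_num
  have e7 : δ ^ (7 / 2 : ℝ) = Real.sqrt δ ^ 7 := by
    rw [← rpow_div_two hδ0.le]; norm_num
  rw [e5, e7]
  set β := (hyperFor δ L Δ σ T).β
  set τ := (hyperFor δ L Δ σ T).τ
  set η := (hyperFor δ L Δ σ T).η
  set B := (hyperFor δ L Δ σ T).B
  set q := noiseRatio δ L Δ σ T
  set u := Real.sqrt δ
  have hu0 : 0 < u := Real.sqrt_pos.2 hδ0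
  have hδ : δ = u ^ 2 := (Real.sq_sqrt hδ0.le).symm
  have hB0 : (0 : ℝ) < B := by linarith
  -- In terms of `W` and `q` the target is `W + W q`. The optimization term is of order `W/β = W(1 +
  -- q)`, and the noise term `βσ²/δ = (βq) W q` is at most `W q`: this is the balance behind `β`.
  set W := L * Δ / (u ^ 5 * T) with hW
  have hW0 : 0 < W := by positivity
  have hR : Real.sqrt (L * Δ * σ ^ 2 / (u ^ 7 * T)) = W * q := by
    have : L * Δ * σ ^ 2 / (u ^ 7 * T) = (W * q) ^ 2 := by
      rw [mul_pow, hq, hW]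
      field_simp
    rw [this, Real.sqrt_sq (by positivity)]
  rw [hR]
  have hσ : σ ^ 2 = q ^ 2 * (u ^ 2 * W) := by
    rw [hq, hW]
    field_simp
  have hbq : β * q ≤ 1 := by
    rw [hβq, inv_mul_le_iff₀ (by positivity)]
    linarith
  have hnoise : β * σ ^ 2 / δ ≤ W * q := by
    calc β * σ ^ 2 / δ = (β * q) * (W * q) := by rw [hσ, hδ]; field_simp
      _ ≤ 1 * (W * q) := by gcongr
      _ = W * q := one_mul _
  have main1 : (K * τ) / T * (16 * Δ / (δ * η * K * τ)) ≤ 2992 * (W * (1 + q)) := by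
    calc (K * τ) / T * (16 * Δ / (δ * η * K * τ)) = 16 * Δ / (δ * T) * η⁻¹ := by field_simp
      _ ≤ 16 * Δ / (δ * T) * (187 * L / (u ^ 3 * β)) := by gcongr
      _ = 2992 * (W * (1 + q)) := by
        rw [hβq, hδ, hW]
        field_simp
        ring
  have hBinv : 1 / (B : ℝ) ≤ δ * β := by
    rw [div_le_iff₀ hB0]
    rw [div_le_iff₀ (by positivity)] at hB
    linarith
  have n1 : 160 / (3 * β * δ * τ * B) ≤ 5 / 2 * (δ * β) := by
    have : 64 ≤ 3 * β * δ * τ := by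
      rw [div_le_iff₀ (by positivity)] at hτ1
      linarith
    calc 160 / (3 * β * δ * τ * B) = 160 / (3 * β * δ * τ) * (1 / B) := by field_simp
      _ ≤ 160 / 64 * (δ * β) := by gcongr
      _ = 5 / 2 * (δ * β) := by ring
  have n1' : δ * β ≤ β / δ := by
    rw [le_div_iff₀ hδ0]
    have : δ * δ ≤ 1 := mul_le_one₀ hδ1 hδ0.le hδ1
    nlinarith
  have n2 : 352 / (3 * δ ^ 2 * B) ≤ 352 / 3 * (β / δ) := by
    calc 352 / (3 * δ ^ 2 * B) = 352 / (3 * δ ^ 2) * (1 / B) := by field_simp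
      _ ≤ 352 / (3 * δ ^ 2) * (δ * β) := by gcongr
      _ = 352 / 3 * (β / δ) := by field_simp
  have n3 : 32 * β / (3 * δ) = 32 / 3 * (β / δ) := by field_simp
  -- `5/2 + 352/3 + 32/3 ≤ 131`; with `Kτ ≤ 2T` the total is `2992 + 2 * 131 ≤ 3300`.
  have n4 : (160 / (3 * β * δ * τ * B) + 352 / (3 * δ ^ 2 * B) + 32 * β / (3 * δ)) * σ ^ 2 ≤
      131 * (W * q) := by
    have p : 0 ≤ β / δ := by positivity
    calc _ ≤ 131 * (β / δ) * σ ^ 2 := by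
          refine mul_le_mul_of_nonneg_right ?_ (sq_nonneg σ)
          linarith
      _ = 131 * (β * σ ^ 2 / δ) := by ring
      _ ≤ _ := by linarith
  have hKT : (K * τ) / T ≤ (2 : ℝ) := by rw [div_le_iff₀ hT]; linarith
  have hKT0 : 0 ≤ (K * τ) / (T : ℝ) := by positivity
  have hWq : 0 ≤ W * q := by positivity
  rw [mul_add]
  have main2 := mul_le_mul hKT n4 (by positivity) (by norm_num)
  linarith

theorem exists_periods (T : ℕ) {τ : ℕ} (hτ : 0 < τ) (h : τ ≤ T) :
    ∃ K : ℕ, 0 < K ∧ T ≤ K * τ ∧ K * τ ≤ 2 * T := by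
  refine ⟨T / τ + 1, Nat.succ_pos _, ?_, ?_⟩
  · have := Nat.lt_div_mul_add hτ (a := T)
    nlinarith
  · have := Nat.div_mul_le_self T τ
    nlinarith

/-- Each period has one batch, of size `B ≤ τ`, so the batches of `K` periods cost at most `Kτ ≤ 2T`
on top of one sample per iteration. -/
theorem LongHorizon.gradEvals_le (h : LongHorizon δ L Δ σ T) (hδ0 : 0 < δ) (hL : 0 < L)
    (hΔ : 0 < Δ) : ((hyperFor δ L Δ σ T).gradEvals T : ℝ) ≤ 3 * T := by
  have hτ0 := hyperFor_tau_pos (L := L) (Δ := Δ) (σ := σ) (T := T) hδ0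
  obtain ⟨K, -, hK1, hK2⟩ := exists_periods T hτ0 (h.tau_le hδ0 hL hΔ)
  have hBτ : ((hyperFor δ L Δ σ T).B : ℝ) ≤ (hyperFor δ L Δ σ T).τ := by
    exact_mod_cast hyperFor_B_le_tau hδ0
  have hK2' : (K : ℝ) * (hyperFor δ L Δ σ T).τ ≤ 2 * T := by exact_mod_cast hK2
  unfold Hyper.gradEvals
  push_cast
  calc ∑ t ∈ Finset.range T, ((hyperFor δ L Δ σ T).batch t : ℝ)
      ≤ ∑ t ∈ Finset.range T,
        (1 + if t % (hyperFor δ L Δ σ T).τ = 0 then ((hyperFor δ L Δ σ T).B : ℝ) else 0) := by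
        refine Finset.sum_le_sum fun t _ => ?_
        unfold Hyper.batch
        split_ifs <;> simp
    _ = T + ∑ t ∈ Finset.range T,
        (if t % (hyperFor δ L Δ σ T).τ = 0 then ((hyperFor δ L Δ σ T).B : ℝ) else 0) := by
        rw [Finset.sum_add_distrib]; simp
    _ ≤ T + ∑ t ∈ Finset.range (K * (hyperFor δ L Δ σ T).τ),
        (if t % (hyperFor δ L Δ σ T).τ = 0 then ((hyperFor δ L Δ σ T).B : ℝ) else 0) := by
        gcongr
    _ = T + K * (hyperFor δ L Δ σ T).B := by
        rw [sum_range_mul_ite (fun _ => ((hyperFor δ L Δ σ T).B : ℝ)) K hτ0]; simp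
    _ ≤ T + K * (hyperFor δ L Δ σ T).τ := by gcongr
    _ ≤ 3 * T := by linarith

end Horizon

/-! ### Convergence rate and sample complexity -/

section Rate

variable {A : Arch} {Ξ : Type*} [MeasurableSpace Ξ] {D : Measure Ξ} {F : A.Params → Ξ → ℝ}
  {σ : Fin A.N → ℝ} {Ω : Type*} [MeasurableSpace Ω] {μ : Measure Ω}
  {ξ : ℕ → ℕ → Ω → Ξ} {L : ℝ} {svd : SVDRule A}

theorem AvgGradSqLE.mono {f : A.Params → ℝ} {X : ℕ → Ω → A.Params} {T : ℕ} {a b : ℝ}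
    (h : AvgGradSqLE μ f X T a) (hab : a ≤ b) : AvgGradSqLE μ f X T b :=
  ⟨h.1, h.2.trans hab⟩

/-- The summands are nonnegative, so a horizon inside a period can be extended to its end. -/
theorem AvgGradSqLE.of_le {f : A.Params → ℝ} {X : ℕ → Ω → A.Params} {T T' : ℕ} {a : ℝ}
    (h : AvgGradSqLE μ f X T' a) (hT : 0 < T) (hTT : T ≤ T') :
    AvgGradSqLE μ f X T ((T' : ℝ) / T * a) := by
  refine ⟨fun t ht => h.1 t (ht.trans_le hTT), ?_⟩
  have hT0 : (0 : ℝ) < T := by exact_mod_cast hT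
  have hT0' : (0 : ℝ) < T' := by exact_mod_cast hT.trans_le hTT
  have h1 : ∑ t ∈ Finset.range T, ∫ ω, ‖gradient f (X t ω)‖ ^ 2 ∂μ ≤
      ∑ t ∈ Finset.range T', ∫ ω, ‖gradient f (X t ω)‖ ^ 2 ∂μ :=
    Finset.sum_le_sum_of_subset_of_nonneg (Finset.range_mono hTT) fun t _ _ =>
      integral_nonneg fun _ => sq_nonneg _
  calc _ ≤ 1 / (T : ℝ) * ∑ t ∈ Finset.range T', ∫ ω, ‖gradient f (X t ω)‖ ^ 2 ∂μ := by gcongr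
    _ = (T' : ℝ) / T *
        (1 / (T' : ℝ) * ∑ t ∈ Finset.range T', ∫ ω, ‖gradient f (X t ω)‖ ^ 2 ∂μ) := by
        field_simp
    _ ≤ _ := mul_le_mul_of_nonneg_left h.2 (by positivity)

theorem avgGradSqLE_horizon [IsProbabilityMeasure μ] [IsProbabilityMeasure D]
    (hL : 0 < L) (hb : LowerBounded (objective D F))
    (hsm : LSmooth (objective D F) L) (hF : StochasticGradient D F σ)
    (hs : svd.Valid) (hξ : IIDSamples D μ ξ) (x0 : A.Params)
    (hΔ : 0 < gap (objective D F) x0) {T : ℕ}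
    (h : LongHorizon A.minDelta L (gap (objective D F) x0) (totalSigma σ) T) :
    AvgGradSqLE μ (objective D F)
      (iterate (hyperFor A.minDelta L (gap (objective D F) x0) (totalSigma σ) T) F svd x0 ξ) T
      (3300 * (L * gap (objective D F) x0 / (A.minDelta ^ (5 / 2 : ℝ) * T) +
        Real.sqrt (L * gap (objective D F) x0 * totalSigma σ ^ 2 /
          (A.minDelta ^ (7 / 2 : ℝ) * T)))) := by
  have hδ0 := minDelta_pos A
  have hδ1 := minDelta_le_one A
  obtain ⟨K, hK, hK1, hK2⟩ := exists_periods T (hyperFor_tau_pos hδ0) (h.tau_le hδ0 hL hΔ)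
  obtain ⟨h1, h2, h3, h4⟩ := hyperFor_eta_le (Δ := gap (objective D F) x0) (σ := totalSigma σ)
    (T := T) hδ0 hL
  have hT : 0 < T := by
    have := h.two_le hδ0 hL hΔ
    have : (0 : ℝ) < T := by linarith
    exact_mod_cast this
  refine ((avgGradSqLE_periods hL hb hsm hF hs hξ x0 hyperFor_beta_pos hyperFor_beta_le_one
    le_hyperFor_tau (hyperFor_eta_pos hL) h1 h2 h3 h4 (one_le_hyperFor_B hδ0) hK).of_le hT
      hK1).mono ?_
  push_cast
  exact hyperFor_bound_le h hδ0 hδ1 hL hΔ hK (by exact_mod_cast hK2)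

end Rate

/-- A horizon for accuracy `ε`. -/
theorem exists_horizon {δ L Δ σ ε : ℝ} (hδ0 : 0 < δ) (hδ1 : δ ≤ 1) (hL : 0 < L) (hΔ : 0 < Δ)
    (hε : 0 < ε) : ∃ T : ℕ, LongHorizon δ L Δ σ T ∧
      3300 * (L * Δ / (δ ^ (5 / 2 : ℝ) * T) + Real.sqrt (L * Δ * σ ^ 2 / (δ ^ (7 / 2 : ℝ) * T))) ≤
        ε ∧
      3 * (T : ℝ) ≤ 12 * 3300 ^ 2 * (L * Δ * σ ^ 2 / (δ ^ (7 / 2 : ℝ) * ε ^ 2) +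
        L * Δ / (δ ^ (5 / 2 : ℝ) * ε) + σ ^ 2 / (δ ^ (1 / 2 : ℝ) * L * Δ) + 1 / δ) := by
  have h5 : 0 < δ ^ (5 / 2 : ℝ) := Real.rpow_pos_of_pos hδ0 _
  have h7 : 0 < δ ^ (7 / 2 : ℝ) := Real.rpow_pos_of_pos hδ0 _
  have hu : 0 < Real.sqrt δ := Real.sqrt_pos.2 hδ0
  rw [← Real.sqrt_eq_rpow]
  set V := L * Δ * σ ^ 2 / (δ ^ (7 / 2 : ℝ) * ε ^ 2) with hV
  set W := L * Δ / (δ ^ (5 / 2 : ℝ) * ε) with hW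
  set b := σ ^ 2 / (Real.sqrt δ * L * Δ) with hb
  have hV0 : 0 ≤ V := by positivity
  have hW0 : 0 < W := by positivity
  have hb0 : 0 ≤ b := by positivity
  have hδ' : 1 ≤ 1 / δ := by rw [le_div_iff₀ hδ0]; linarith
  have eb : (128 * σ) ^ 2 / (9 * Real.sqrt δ * L * Δ) = 16384 / 9 * b := by
    rw [hb]; field_simp; ring
  have ea : 128 / (3 * δ) = 128 / 3 * (1 / δ) := by field_simp
  -- The first three terms ensure `LongHorizon`; the last two bring each part of the rate below
  -- `ε/2`.
  set T0 := 2 + 128 / 3 * (1 / δ) + 16384 / 9 * b + 2 * 3300 * W + 4 * 3300 ^ 2 * V with hT0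
  have hT00 : 0 ≤ T0 := by positivity
  have hle : T0 ≤ ⌈T0⌉₊ := Nat.le_ceil T0
  have hlt : (⌈T0⌉₊ : ℝ) < T0 + 1 := Nat.ceil_lt_add_one hT00
  set T := ⌈T0⌉₊
  have hT : (0 : ℝ) < T := by
    have : 0 < T0 := by positivity
    linarith
  refine ⟨T, ?_, ?_, ?_⟩
  · unfold LongHorizon
    rw [eb, ea]
    linarith
  · have e1 : L * Δ / (δ ^ (5 / 2 : ℝ) * T) ≤ ε / (2 * 3300) := by
      have : L * Δ / (δ ^ (5 / 2 : ℝ) * T) = W * ε / T := by rw [hW]; field_simp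
      rw [this, div_le_div_iff₀ hT (by norm_num)]
      nlinarith
    have e2 : Real.sqrt (L * Δ * σ ^ 2 / (δ ^ (7 / 2 : ℝ) * T)) ≤ ε / (2 * 3300) := by
      rw [Real.sqrt_le_left (by positivity)]
      have : L * Δ * σ ^ 2 / (δ ^ (7 / 2 : ℝ) * T) = V * ε ^ 2 / T := by rw [hV]; field_simp
      rw [this, div_pow, div_le_div_iff₀ hT (by norm_num)]
      have hVT : 4 * 3300 ^ 2 * V ≤ T := by linarith
      nlinarith [mul_le_mul_of_nonneg_right hVT (sq_nonneg ε)]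
    linarith
  · linarith

end GaLore

theorem theorem3 :
    ∃ C : ℝ, 0 < C ∧
      ∀ (A : GaLore.Arch)
        (Ξ : Type*) [MeasurableSpace Ξ] (D : Measure Ξ) [IsProbabilityMeasure D]
        (F : A.Params → Ξ → ℝ) (L : ℝ) (σ : Fin A.N → ℝ) (x0 : A.Params)
        (svd : GaLore.SVDRule A)
        (Ω : Type*) [MeasurableSpace Ω] (μ : Measure Ω) [IsProbabilityMeasure μ]
        (ξ : ℕ → ℕ → Ω → Ξ),
        0 < L → (∀ l, 0 ≤ σ l) →
        GaLore.LowerBounded (GaLore.objective D F) →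
        GaLore.LSmooth (GaLore.objective D F) L →
        GaLore.StochasticGradient D F σ →
        svd.Valid →
        GaLore.IIDSamples D μ ξ →
        -- explicit bound after `K` periods, for a range of hyperparameters
        (∀ (H : GaLore.Hyper) (K : ℕ),
          0 < H.β → H.β ≤ 1 →
          64 / (3 * H.β * A.minDelta) ≤ (H.τ : ℝ) →
          0 < H.η →
          H.η ≤ 1 / (4 * L) →
          H.η ≤ Real.sqrt (3 * A.minDelta * H.β ^ 2 / (80 * L ^ 2)) →
          H.η ≤ Real.sqrt (A.minDelta / (40 * (H.τ : ℝ) ^ 2 * L ^ 2)) →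
          H.η ≤ Real.sqrt (3 * H.β / (32 * (H.τ : ℝ) * L ^ 2)) →
          1 ≤ H.B → 1 ≤ K →
          GaLore.AvgGradSqLE μ (GaLore.objective D F) (GaLore.iterate H F svd x0 ξ) (K * H.τ)
            (16 * GaLore.gap (GaLore.objective D F) x0 / (A.minDelta * H.η * K * H.τ) +
              (160 / (3 * H.β * A.minDelta * H.τ * H.B) +
                352 / (3 * A.minDelta ^ 2 * H.B) +
                32 * H.β / (3 * A.minDelta)) * GaLore.totalSigma σ ^ 2)) ∧
        -- the rate with the hyperparameters chosen for the horizon `T`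
        (0 < GaLore.gap (GaLore.objective D F) x0 →
          ∀ T : ℕ,
          GaLore.LongHorizon A.minDelta L (GaLore.gap (GaLore.objective D F) x0)
            (GaLore.totalSigma σ) T →
          GaLore.AvgGradSqLE μ (GaLore.objective D F)
            (GaLore.iterate
              (GaLore.hyperFor A.minDelta L (GaLore.gap (GaLore.objective D F) x0)
                (GaLore.totalSigma σ) T) F svd x0 ξ) T
            (C * (L * GaLore.gap (GaLore.objective D F) x0 / (A.minDelta ^ (5 / 2 : ℝ) * T) +
              Real.sqrt (L * GaLore.gap (GaLore.objective D F) x0 * GaLore.totalSigma σ ^ 2 /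
                (A.minDelta ^ (7 / 2 : ℝ) * T))))) ∧
        -- the number of stochastic gradients that suffices for accuracy `ε`
        (0 < GaLore.gap (GaLore.objective D F) x0 →
          ∀ ε : ℝ, 0 < ε →
          ∃ T : ℕ,
            GaLore.LongHorizon A.minDelta L (GaLore.gap (GaLore.objective D F) x0)
              (GaLore.totalSigma σ) T ∧
            GaLore.AvgGradSqLE μ (GaLore.objective D F)
              (GaLore.iterate
                (GaLore.hyperFor A.minDelta L (GaLore.gap (GaLore.objective D F) x0)
                  (GaLore.totalSigma σ) T) F svd x0 ξ) T ε ∧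
            ((GaLore.hyperFor A.minDelta L (GaLore.gap (GaLore.objective D F) x0)
                (GaLore.totalSigma σ) T).gradEvals T : ℝ) ≤
              C * (L * GaLore.gap (GaLore.objective D F) x0 * GaLore.totalSigma σ ^ 2 /
                    (A.minDelta ^ (7 / 2 : ℝ) * ε ^ 2) +
                  L * GaLore.gap (GaLore.objective D F) x0 / (A.minDelta ^ (5 / 2 : ℝ) * ε) +
                  GaLore.totalSigma σ ^ 2 /
                    (A.minDelta ^ (1 / 2 : ℝ) * L * GaLore.gap (GaLore.objective D F) x0) +
                  1 / A.minDelta)) := by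
  -- Dictated by the complexity bound, `3 * (4 * 3300²)` from the `V` term of `exists_horizon`; it
  -- exceeds the `3300` of the rate.
  refine ⟨12 * 3300 ^ 2, by norm_num, ?_⟩
  intro A Ξ _ D _ F L σ x0 svd Ω _ μ _ ξ hL _ hb hsm hF hs hξ
  refine ⟨fun H K hβ0 hβ1 hτ hη h1 h2 h3 h4 hB hK =>
    GaLore.avgGradSqLE_periods hL hb hsm hF hs hξ x0 hβ0 hβ1 hτ hη h1 h2 h3 h4 hB hK,
    fun hΔ T hT => ?_, fun hΔ ε hε => ?_⟩
  · refine (GaLore.avgGradSqLE_horizon hL hb hsm hF hs hξ x0 hΔ hT).mono ?_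
    have hδ := GaLore.minDelta_pos A
    refine mul_le_mul_of_nonneg_right (by norm_num) (by positivity)
  · obtain ⟨T, hT, hTε, hTC⟩ := GaLore.exists_horizon (σ := GaLore.totalSigma σ)
      (GaLore.minDelta_pos A) (GaLore.minDelta_le_one A) hL hΔ hε
    exact ⟨T, hT, (GaLore.avgGradSqLE_horizon hL hb hsm hF hs hξ x0 hΔ hT).mono hTε,
      (hT.gradEvals_le (GaLore.minDelta_pos A) hL hΔ).trans hTC⟩
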